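/- Let $(T_i)_{i\ge1}$ and $(Y_i)_{i\ge1}$ be two sequences of nonnegative random variables on one probability space, each negatively associated (NA): for any disjoint finite index sets $B_1,B_2$ and any measurable $\varphi_1,\varphi_2$ that are both increasing, or both decreasing, in every variable, $\operatorname{cov}(\varphi_1(T_i;i\in B_1),\varphi_2(T_j;j\in B_2))\le 0$ whenever this covariance exists, and likewise for $(Y_i)$. Suppose that the sequence $(T_i)$ is independent of the sequence $(Y_i)$, that the $T_i$ have a common distribution function $F$ with density $f$, and that the $Y_i$ have a common distribution function $G$. Put $X_i=\min(T_i,Y_i)$ and $\delta_i=\mathbf 1\{T_i\le Y_i\}$, let $L$ be the distribution function of $X_1$, and set $a_F=\inf\{x:F(x)>0\}$, $\tau_L=\sup\{x:L(x)<1\}\in(0,\infty]$. Let $a_F<\tau<\tau_L$, and suppose that $G$ has a density $g$ on $[0,\tau]$ and that $f$ and $g$ are bounded on $[0,\tau]$. Let $k$ be a probability density of bounded variation on a finite interval $(r,s)$, $r<0<s$, vanishing outside $(r,s)$, and let $b_n>0$ satisfy $b_n\to0$ and $b_n^{-1}=o\big((n/\ln n)^{1/2}\big)$. With $N_n(t)=\sum_{i\le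 n}\mathbf 1\{X_i\le t,\delta_i=1\}$, $Y_n(t)=\sum_{i\le n}\mathbf 1\{X_i\ge t\}$, $\hat H_n(x)=\int_0^x dN_n(s)/Y_n(s)$, $h=f/(1-F)$ and $H(x)=\int_0^x h(s)\,ds$, define $$h_n(t)=b_n^{-1}\int_{a_F}^\infty k\Big(\frac{t-x}{b_n}\Big)d\hat H_n(x),\quad \bar h_n(t)=b_n^{-1}\int_{a_F}^\infty k\Big(\frac{t-x}{b_n}\Big)dH(x),\quad f_n^*(t)=b_n^{-1}\int_{a_F}^\infty k\Big(\frac{t-x}{b_n}\Big)dF_{*n}(x),$$ where $F_{*n}(x)=\frac1n\sum_{i\le n}\mathbf 1\{X_i\le x,\delta_i=1\}$. Then, almost surely, as $n\to\infty$, $$\sup_{0<t\le\tau}\Big|h_n(t)-\bar h_n(t)-\frac{f_n^*(t)-E f_n^*(t)}{1-L(t)}\Big|=O\Big(b_n^{-1}\Big(\frac{\ln n}{n}\Big)^{1/2}\Big).$$ The same holds if instead $F_{*n}(x)=\frac1n\sum_{i\le n}\mathbf 1\{T_i\le x\}$ in the definition of $f_n^*$. -/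

import Mathlib

open MeasureTheory ProbabilityTheory Filter Topology

namespace CensoredNA

noncomputable section

/-- A sequence of real random variables is negatively associated (NA): for any two disjoint finite
index sets `B₁`, `B₂` and any (Borel) functions `φ₁`, `φ₂` that are both increasing, or both
decreasing, in every variable, the covariance of `φ₁ (T i; i ∈ B₁)` and `φ₂ (T j; j ∈ B₂)` is
nonpositive whenever it exists. -/
def NegAssociated {Ω : Type*} [MeasurableSpace Ω] (μ : Measure Ω) (T : ℕ → Ω → ℝ) : Prop :=
  ∀ B₁ B₂ : Finset ℕ, Disjoint B₁ B₂ →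
    ∀ (φ₁ : (B₁ → ℝ) → ℝ) (φ₂ : (B₂ → ℝ) → ℝ), Measurable φ₁ → Measurable φ₂ →
      ((Monotone φ₁ ∧ Monotone φ₂) ∨ (Antitone φ₁ ∧ Antitone φ₂)) →
      Integrable (fun ω => φ₁ (fun i => T i ω)) μ →
      Integrable (fun ω => φ₂ (fun j => T j ω)) μ →
      Integrable (fun ω => φ₁ (fun i => T i ω) * φ₂ (fun j => T j ω)) μ →
      covariance (fun ω => φ₁ (fun i => T i ω)) (fun ω => φ₂ (fun j => T j ω)) μ ≤ 0

/-- The distribution function `t ↦ P(X ≤ t)` of a real random variable. -/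
def distFun {Ω : Type*} [MeasurableSpace Ω] (μ : Measure Ω) (X : Ω → ℝ) (t : ℝ) : ℝ :=
  cdf (μ.map X) t

/-- Left endpoint `inf {x : H x > 0}` of the support of a distribution function on `[0, ∞)`. -/
def leftEndpoint (H : ℝ → ℝ) : ℝ := sInf {x : ℝ | 0 < H x}

/-- Right endpoint `sup {x : H x < 1}` of the support of a distribution function, possibly `∞`. -/
def rightEndpoint (H : ℝ → ℝ) : EReal := ⨆ x ∈ {x : ℝ | H x < 1}, (x : EReal)

/-- The observed time `X i = min (T i) (Y i)`. The observation is uncensored (`δ i = 1`) exactly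
when `T i ≤ Y i`. -/
def obs {Ω : Type*} (T Y : ℕ → Ω → ℝ) (i : ℕ) (ω : Ω) : ℝ := min (T i ω) (Y i ω)

open Classical in
/-- The number at risk, `Y_n(t) = #{k : X k ≥ t}` over the first `n` observations. -/
def atRisk {Ω : Type*} (T Y : ℕ → Ω → ℝ) (n : ℕ) (ω : Ω) (t : ℝ) : ℕ :=
  ((Finset.range n).filter fun k => t ≤ obs T Y k ω).card

open Classical in
/-- The measure `dN_n`, where `N_n(t) = #{k : X k ≤ t, δ k = 1}` over the first `n`
observations. -/
def eventMeasure {Ω : Type*} (T Y : ℕ → Ω → ℝ) (n : ℕ) (ω : Ω) : Measure ℝ :=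
  ∑ k ∈ (Finset.range n).filter (fun k => T k ω ≤ Y k ω), Measure.dirac (obs T Y k ω)

/-- The measure `dĤ_n = dN_n / Y_n` of the Nelson–Aalen estimator
`Ĥ_n(x) = ∫_0^x dN_n(s) / Y_n(s)`. -/
def nelsonAalen {Ω : Type*} (T Y : ℕ → Ω → ℝ) (n : ℕ) (ω : Ω) : Measure ℝ :=
  (eventMeasure T Y n ω).withDensity fun s => ((atRisk T Y n ω s : ℕ) : ENNReal)⁻¹

/-- The measure `dF_{*n}`, with `F_{*n}(t) = n⁻¹ #{k : X k ≤ t, δ k = 1} = N_n(t) / n`. -/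
def subEmpirical {Ω : Type*} (T Y : ℕ → Ω → ℝ) (n : ℕ) (ω : Ω) : Measure ℝ :=
  (n : ENNReal)⁻¹ • eventMeasure T Y n ω

/-- The empirical measure of the survival times, with distribution function
`n⁻¹ #{k : T k ≤ t}`. -/
def survivalEmpirical {Ω : Type*} (T : ℕ → Ω → ℝ) (n : ℕ) (ω : Ω) : Measure ℝ :=
  (n : ENNReal)⁻¹ • ∑ k ∈ Finset.range n, Measure.dirac (T k ω)

/-- The hazard function `h = f / (1 - F)`. -/
def hazard (f F : ℝ → ℝ) (x : ℝ) : ℝ := f x / (1 - F x)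

/-- The measure `dH`, where `H(x) = ∫_0^x h(s) ds` is the cumulative hazard. -/
def cumHazard (f F : ℝ → ℝ) : Measure ℝ :=
  volume.withDensity fun x => ENNReal.ofReal (hazard f F x)

/-- Kernel smoothing of a measure: `b⁻¹ ∫_a^∞ k((t - x) / b) dν(x)`. -/
def smooth (k : ℝ → ℝ) (b a : ℝ) (ν : Measure ℝ) (t : ℝ) : ℝ :=
  b⁻¹ * ∫ x in Set.Ioi a, k ((t - x) / b) ∂ν

/-- The kernel hazard estimator `h_n(t) = b⁻¹ ∫_a^∞ k((t - x) / b) dĤ_n(x)`. -/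
def hazardEstimator {Ω : Type*} (T Y : ℕ → Ω → ℝ) (k : ℝ → ℝ) (b a : ℝ) (n : ℕ) (t : ℝ) (ω : Ω) :
    ℝ :=
  smooth k b a (nelsonAalen T Y n ω) t

/-- Its centring `b⁻¹ ∫_a^∞ k((t - x) / b) dH(x)`. -/
def hazardCentring (f F k : ℝ → ℝ) (b a t : ℝ) : ℝ :=
  smooth k b a (cumHazard f F) t

/-- `f_n^*(t) = b⁻¹ ∫_a^∞ k((t - x) / b) dF_{*n}(x)`, with `F_{*n}` the empirical
sub-distribution function of the uncensored observations. -/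
def fStar {Ω : Type*} (T Y : ℕ → Ω → ℝ) (k : ℝ → ℝ) (b a : ℝ) (n : ℕ) (t : ℝ) (ω : Ω) : ℝ :=
  smooth k b a (subEmpirical T Y n ω) t

/-- The variant of `f_n^*` in which `F_{*n}` is the empirical distribution function
`n⁻¹ #{k : T k ≤ t}` of the survival times. -/
def fStarSurvival {Ω : Type*} (T : ℕ → Ω → ℝ) (k : ℝ → ℝ) (b a : ℝ) (n : ℕ) (t : ℝ) (ω : Ω) : ℝ :=
  smooth k b a (survivalEmpirical T n ω) t

/-- `sup_{0 < t ≤ τ} |D n t| = O(b_n⁻¹ (n⁻¹ ln n)^{1/2})` as `n → ∞`. -/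
def UniformRate (τ : ℝ) (b : ℕ → ℝ) (D : ℕ → ℝ → ℝ) : Prop :=
  ∃ C : ℝ, ∀ᶠ n : ℕ in atTop, ∀ t ∈ Set.Ioc 0 τ,
    |D n t| ≤ C * ((b n)⁻¹ * Real.sqrt (Real.log n / n))

end

end CensoredNA

/-!
The centred `f_n^*` and the difference of `h_n` and its centring are each
`O(b_n⁻¹ (n⁻¹ ln n)^{1/2})` on their own. A kernel of bounded variation is a difference of monotone
functions, so by the layer-cake formula its integrals against two finite measures on the line differ
by at most a constant times the Kolmogorov distance of the measures. Both `dĤ_n` and `dH` are the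
law of the uncensored observations divided by the probability of being at risk, under the empirical
measure of the pairs `(T i, Y i)` and under their true law respectively; up to a point `c > τ` with
`L c < 1` that division preserves the estimate.

The Kolmogorov distances are `O((n⁻¹ ln n)^{1/2})` almost surely: by negative association and
independence `E ∏ φ_i(T i, Y i) ≤ ∏ E φ_i(T i, Y i)` whenever the `φ_i ≥ 0` are monotone in each
coordinate, in a direction common to all `i`. This covers exponentials of the indicators of
`{T ≤ Y, T ∈ S}`, `{min T Y ∈ S}` and `{T ∈ S}` for a lower set `S`, hence Hoeffding's inequality
holds for these events, and bracketing and the Borel–Cantelli lemma give the rate.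
-/

namespace CensoredNA

section KolmogorovDistance

/-- `ν₁` and `ν₂` are at Kolmogorov distance at most `δ`. Testing on all lower sets rather than on
the closed rays `Iic t` covers the left limits of the distribution functions as well. -/
def KolmogorovClose {α : Type*} [LE α] [MeasurableSpace α] (ν₁ ν₂ : Measure α) (δ : ℝ) : Prop :=
  ∀ S, IsLowerSet S → |ν₁.real S - ν₂.real S| ≤ δ

variable {α : Type*} [LinearOrder α] [TopologicalSpace α] [OrderTopology α]
  [MeasurableSpace α] [BorelSpace α]

theorem measurableSet_of_isLowerSet {S : Set α} (hS : IsLowerSet S) : MeasurableSet S :=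
  hS.ordConnected.measurableSet

theorem KolmogorovClose.abs_measureReal_sub_le_of_ordConnected {ν₁ ν₂ : Measure α}
    [IsFiniteMeasure ν₁] [IsFiniteMeasure ν₂] {δ : ℝ} (h : KolmogorovClose ν₁ ν₂ δ) {J : Set α}
    (hJ : J.OrdConnected) : |ν₁.real J - ν₂.real J| ≤ 2 * δ := by
  have hU : IsLowerSet (lowerClosure J : Set α) := (lowerClosure J).lower
  have hD : IsLowerSet ((lowerClosure J : Set α) \ J) := by
    rintro y x hxy ⟨hy, hyJ⟩
    refine ⟨hU hxy hy, fun hx => hyJ ?_⟩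
    obtain ⟨z, hz, hyz⟩ := hy
    exact hJ.out hx hz ⟨hxy, hyz⟩
  have hsplit (ν : Measure α) [IsFiniteMeasure ν] :
      ν.real J = ν.real (lowerClosure J : Set α) - ν.real ((lowerClosure J : Set α) \ J) := by
    rw [measureReal_sdiff subset_lowerClosure hJ.measurableSet, sub_sub_cancel]
  calc |ν₁.real J - ν₂.real J|
      = |(ν₁.real (lowerClosure J : Set α) - ν₂.real (lowerClosure J : Set α)) -
          (ν₁.real ((lowerClosure J : Set α) \ J) - ν₂.real ((lowerClosure J : Set α) \ J))| := by
        rw [hsplit ν₁, hsplit ν₂, sub_sub_sub_comm]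
    _ ≤ δ + δ := (abs_sub _ _).trans (add_le_add (h _ hU) (h _ hD))
    _ = 2 * δ := (two_mul δ).symm

theorem measurable_indicator_of_monotoneOn {J : Set α} (hJ : J.OrdConnected) {φ : α → ℝ}
    (hφ : MonotoneOn φ J) : Measurable (J.indicator φ) := by
  have := hJ
  have hmono : Monotone fun x : J => φ x := Set.monotoneOn_iff_monotone.1 hφ
  refine measurable_of_restrict_of_restrict_compl hJ.measurableSet ?_ ?_
  · convert hmono.measurable using 1
    exact funext fun x => Set.indicator_of_mem x.2 φ
  · convert measurable_const (a := (0 : ℝ)) using 1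
    exact funext fun x => Set.indicator_of_notMem x.2 φ

theorem integrableOn_of_monotoneOn {ν : Measure α} [IsFiniteMeasure ν] {J : Set α}
    (hJ : J.OrdConnected) {φ : α → ℝ} (hφ : MonotoneOn φ J) {M : ℝ}
    (hM : Set.MapsTo φ J (Set.Icc 0 M)) : IntegrableOn φ J ν := by
  refine Integrable.of_bound
    (aemeasurable_restrict_of_monotoneOn hJ.measurableSet hφ).aestronglyMeasurable M ?_
  filter_upwards [ae_restrict_mem hJ.measurableSet] with x hx
  rw [Real.norm_of_nonneg (hM hx).1]
  exact (hM hx).2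

theorem setIntegral_eq_integral_measureReal_le {ν : Measure α} [IsFiniteMeasure ν] {J : Set α}
    (hJ : J.OrdConnected) {φ : α → ℝ} (hφ : MonotoneOn φ J) {M : ℝ}
    (hM : Set.MapsTo φ J (Set.Icc 0 M)) :
    ∫ x in J, φ x ∂ν = ∫ u in Set.Ioc 0 M, ν.real ({x | u ≤ φ x} ∩ J) := by
  have hJm := hJ.measurableSet
  rw [(integrableOn_of_monotoneOn hJ hφ hM).integral_eq_integral_Ioc_meas_le (M := M)
    ((ae_restrict_mem hJm).mono fun x hx => (hM hx).1)
    ((ae_restrict_mem hJm).mono fun x hx => (hM hx).2)]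
  simp only [measureReal_restrict_apply' hJm]

theorem KolmogorovClose.abs_setIntegral_sub_le_of_monotoneOn {ν₁ ν₂ : Measure α}
    [IsFiniteMeasure ν₁] [IsFiniteMeasure ν₂] {δ : ℝ} (h : KolmogorovClose ν₁ ν₂ δ) {J : Set α}
    (hJ : J.OrdConnected) {φ : α → ℝ} (hφ : MonotoneOn φ J) {M : ℝ} (hM0 : 0 ≤ M)
    (hM : Set.MapsTo φ J (Set.Icc 0 M)) :
    |∫ x in J, φ x ∂ν₁ - ∫ x in J, φ x ∂ν₂| ≤ 2 * M * δ := by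
  have hint (ν : Measure α) [IsFiniteMeasure ν] :
      IntegrableOn (fun u => ν.real ({x | u ≤ φ x} ∩ J)) (Set.Ioc 0 M) volume := by
    have hanti : Antitone fun u => ν.real ({x | u ≤ φ x} ∩ J) := fun u v huv =>
      measureReal_mono (Set.inter_subset_inter_left J fun x hx => huv.trans hx)
    exact (hanti.antitoneOn _).integrableOn_isCompact isCompact_Icc |>.mono_set
      Set.Ioc_subset_Icc_self
  have hlevel (u : ℝ) : ({x | u ≤ φ x} ∩ J).OrdConnected :=
    ⟨fun x hx y hy z hz => have hzJ := hJ.out hx.2 hy.2 hz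
      ⟨hx.1.trans (hφ hx.2 hzJ hz.1), hzJ⟩⟩
  rw [setIntegral_eq_integral_measureReal_le hJ hφ hM,
    setIntegral_eq_integral_measureReal_le hJ hφ hM, ← integral_sub (hint ν₁) (hint ν₂),
    ← Real.norm_eq_abs]
  refine (norm_setIntegral_le_of_norm_le_const (C := 2 * δ) (by simp) fun u _ =>
    h.abs_measureReal_sub_le_of_ordConnected (hlevel u)).trans_eq ?_
  rw [Real.volume_real_Ioc_of_le hM0]
  ring

end KolmogorovDistance

section Bracketing

variable {α : Type*} [LinearOrder α] [MeasurableSpace α] {ν : Measure α} [IsFiniteMeasure ν]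
  {A S : Set α} {c : ℝ}

/-- The largest lower set of measure at most `c`: a ray ending at the `c`-quantile, which brackets
the lower sets of measure at most `c` from outside. -/
def upperQuantileSet (ν : Measure α) (c : ℝ) : Set α := {t | ν.real (Set.Iic t) ≤ c}

/-- The smallest lower set of measure at least `c`: a ray ending at the `c`-quantile, which brackets
the lower sets of measure at least `c` from inside. -/
def lowerQuantileSet (ν : Measure α) (c : ℝ) : Set α := {t | ν.real (Set.Iio t) < c}

theorem isLowerSet_upperQuantileSet : IsLowerSet (upperQuantileSet ν c) :=
  fun _ _ hba ha => (measureReal_mono (Set.Iic_subset_Iic.2 hba)).trans ha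

theorem isLowerSet_lowerQuantileSet : IsLowerSet (lowerQuantileSet ν c) :=
  fun _ _ hba ha => (measureReal_mono (Set.Iio_subset_Iio hba)).trans_lt ha

theorem subset_upperQuantileSet (hS : IsLowerSet S) (hSc : ν.real S ≤ c) :
    S ⊆ upperQuantileSet ν c :=
  fun _ ht => (measureReal_mono fun _ hx => hS hx ht).trans hSc

theorem lowerQuantileSet_subset (hS : IsLowerSet S) (hSc : c ≤ ν.real S) :
    lowerQuantileSet ν c ⊆ S := fun t ht => by
  by_contra htS
  have hSt : ν.real S ≤ ν.real (Set.Iio t) :=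
    measureReal_mono fun _ hx => lt_of_not_ge fun h => htS (hS h hx)
  exact (hSc.trans hSt).not_gt ht

theorem measureReal_le_of_isCompact_le {β : Type*} [TopologicalSpace β] [MeasurableSpace β]
    {ν : Measure β} [ν.InnerRegularCompactLTTop] [IsFiniteMeasure ν] {A : Set β} {c : ℝ}
    (hA : MeasurableSet A) (hc : 0 ≤ c)
    (h : ∀ K ⊆ A, IsCompact K → K.Nonempty → ν.real K ≤ c) : ν.real A ≤ c := by
  refine ENNReal.toReal_le_of_le_ofReal hc ?_
  rw [hA.measure_eq_iSup_isCompact_of_ne_top (measure_ne_top ν A)]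
  refine iSup_le fun K => iSup_le fun hKA => iSup_le fun hK => ?_
  rcases K.eq_empty_or_nonempty with rfl | hne
  · simp
  · exact (ENNReal.le_ofReal_iff_toReal_le (measure_ne_top _ _) hc).2 (h K hKA hK hne)

variable [TopologicalSpace α] [OrderTopology α] [ν.InnerRegularCompactLTTop]

theorem measureReal_le_of_Iic_le (hA : MeasurableSet A) (hc : 0 ≤ c)
    (h : ∀ t ∈ A, ν.real (Set.Iic t) ≤ c) : ν.real A ≤ c := by
  refine measureReal_le_of_isCompact_le hA hc fun K hKA hK hne => ?_
  obtain ⟨t, ht, hmax⟩ := hK.exists_isGreatest hne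
  exact (measureReal_mono fun x hx => hmax hx).trans (h t (hKA ht))

theorem measureReal_le_of_Ici_le (hA : MeasurableSet A) (hc : 0 ≤ c)
    (h : ∀ t ∈ A, ν.real (Set.Ici t) ≤ c) : ν.real A ≤ c := by
  refine measureReal_le_of_isCompact_le hA hc fun K hKA hK hne => ?_
  obtain ⟨t, ht, hmin⟩ := hK.exists_isLeast hne
  exact (measureReal_mono fun x hx => hmin hx).trans (h t (hKA ht))

variable [BorelSpace α]

theorem measureReal_upperQuantileSet_le (hc : 0 ≤ c) : ν.real (upperQuantileSet ν c) ≤ c :=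
  measureReal_le_of_Iic_le (measurableSet_of_isLowerSet isLowerSet_upperQuantileSet) hc
    fun _ ht => ht

theorem le_measureReal_lowerQuantileSet (hc : c ≤ ν.real Set.univ) :
    c ≤ ν.real (lowerQuantileSet ν c) := by
  have hm : MeasurableSet (lowerQuantileSet ν c) :=
    measurableSet_of_isLowerSet isLowerSet_lowerQuantileSet
  have hcompl : ν.real (lowerQuantileSet ν c)ᶜ ≤ ν.real Set.univ - c := by
    refine measureReal_le_of_Ici_le hm.compl (sub_nonneg.2 hc) fun t ht => ?_
    have ht' : c ≤ ν.real (Set.Iio t) := not_lt.1 ht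
    rw [← Set.compl_Iio, measureReal_compl measurableSet_Iio]
    gcongr
  rw [measureReal_compl hm] at hcompl
  exact (sub_le_sub_iff_left _).1 hcompl

theorem kolmogorovClose_of_forall_quantileSet {ν' : Measure α} [IsFiniteMeasure ν']
    (hν : ν.real Set.univ ≤ 1) {m : ℕ} (hm : m ≠ 0) {ε : ℝ}
    (hup : ∀ j ∈ Finset.range (m + 2),
      |ν'.real (upperQuantileSet ν (j / m)) - ν.real (upperQuantileSet ν (j / m))| ≤ ε)
    (hlow : ∀ j ∈ Finset.range (m + 2),
      |ν'.real (lowerQuantileSet ν (j / m)) - ν.real (lowerQuantileSet ν (j / m))| ≤ ε) :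
    KolmogorovClose ν' ν (ε + 1 / m) := by
  intro S hS
  have hm' : (0 : ℝ) < m := by positivity
  obtain ⟨j, hj⟩ : ∃ j, j = ⌊m * ν.real S⌋₊ := ⟨_, rfl⟩
  have hSj : (j : ℝ) / m ≤ ν.real S := by
    rw [div_le_iff₀' hm', hj]
    exact Nat.floor_le (by positivity)
  have hSj' : ν.real S ≤ ((j + 1 : ℕ) : ℝ) / m := by
    rw [le_div_iff₀' hm', hj]
    exact_mod_cast (Nat.lt_floor_add_one _).le
  have hstep : ((j + 1 : ℕ) : ℝ) / m = j / m + 1 / m := by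
    push_cast
    exact add_div _ _ _
  have hS1 : ν.real S ≤ ν.real Set.univ := measureReal_mono (Set.subset_univ S)
  have hjm : j ≤ m := by
    have : (j : ℝ) / m ≤ 1 := hSj.trans (hS1.trans hν)
    rw [div_le_one hm'] at this
    exact_mod_cast this
  have hlo := abs_le.1 (hlow j (Finset.mem_range.2 (by lia)))
  have hhi := abs_le.1 (hup (j + 1) (Finset.mem_range.2 (by lia)))
  have h₁ := le_measureReal_lowerQuantileSet (hSj.trans hS1)
  have h₂ := measureReal_mono (μ := ν') (lowerQuantileSet_subset hS hSj)
  have h₃ := measureReal_mono (μ := ν') (subset_upperQuantileSet hS hSj')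
  have h₄ : ν.real (upperQuantileSet ν ((j + 1 : ℕ) / m)) ≤ (j + 1 : ℕ) / m :=
    measureReal_upperQuantileSet_le (by positivity)
  exact abs_le.2 ⟨by linarith [hlo.1], by linarith [hhi.2]⟩

end Bracketing

section NegativeAssociation

/-- The functions of the family `φ` are all increasing or all decreasing. -/
def SameDirection {ι α β : Type*} [Preorder α] [Preorder β] (φ : ι → α → β) : Prop :=
  (∀ i, Monotone (φ i)) ∨ ∀ i, Antitone (φ i)

theorem SameDirection.reindex {ι κ α β : Type*} [Preorder α] [Preorder β] {φ : ι → α → β}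
    (hφ : SameDirection φ) (e : κ → ι) : SameDirection fun j => φ (e j) :=
  hφ.imp (fun h j => h (e j)) fun h j => h (e j)

theorem SameDirection.comp {ι α β γ : Type*} [Preorder α] [Preorder β] [Preorder γ]
    {g : ι → β → γ} {φ : ι → α → β} (hg : SameDirection g) (hφ : SameDirection φ) :
    SameDirection fun i => g i ∘ φ i := by
  rcases hg with hg | hg <;> rcases hφ with hφ | hφ
  · exact .inl fun i => (hg i).comp (hφ i)
  · exact .inr fun i => (hg i).comp_antitone (hφ i)
  · exact .inr fun i => (hg i).comp_monotone (hφ i)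
  · exact .inl fun i => (hg i).comp (hφ i)

theorem SameDirection.measurable {ι : Type*} {φ : ι → ℝ → ℝ} (hφ : SameDirection φ) (i : ι) :
    Measurable (φ i) :=
  hφ.elim (fun h => (h i).measurable) fun h => (h i).measurable

theorem prod_mem_Icc_pow {ι : Type*} {f : ι → ℝ} {M : ℝ} (hf : ∀ i, f i ∈ Set.Icc 0 M)
    (s : Finset ι) : ∏ i ∈ s, f i ∈ Set.Icc 0 (M ^ s.card) :=
  ⟨Finset.prod_nonneg fun i _ => (hf i).1, by
    simpa using Finset.prod_le_prod (fun i _ => (hf i).1) fun i (_ : i ∈ s) => (hf i).2⟩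

variable {Ω : Type*} [MeasurableSpace Ω] {μ : Measure Ω} [IsProbabilityMeasure μ]
  {T Y : ℕ → Ω → ℝ}

theorem NegAssociated.integral_prod_le (hT : NegAssociated μ T) (hTm : ∀ i, Measurable (T i))
    {φ : ℕ → ℝ → ℝ} (hφ : SameDirection φ) {M : ℝ} (hM : ∀ i t, φ i t ∈ Set.Icc 0 M)
    (s : Finset ℕ) : ∫ ω, ∏ i ∈ s, φ i (T i ω) ∂μ ≤ ∏ i ∈ s, ∫ ω, φ i (T i ω) ∂μ := by
  induction s using Finset.induction_on with
  | empty => simp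
  | insert j s hj ih =>
    have hφm := hφ.measurable
    have hj2 : MemLp (fun ω => φ j (T j ω)) 2 μ :=
      memLp_of_bounded (ae_of_all _ fun ω => hM j (T j ω))
        ((hφm j).comp (hTm j)).aestronglyMeasurable 2
    have hs2 : MemLp (fun ω => ∏ i ∈ s, φ i (T i ω)) 2 μ :=
      memLp_of_bounded (ae_of_all _ fun ω => prod_mem_Icc_pow (fun i => hM i (T i ω)) s)
        (Finset.measurable_prod s fun i _ => (hφm i).comp (hTm i)).aestronglyMeasurable 2
    let Φj (x : ({j} : Finset ℕ) → ℝ) : ℝ := φ j (x ⟨j, Finset.mem_singleton_self j⟩)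
    let Φs (x : s → ℝ) : ℝ := ∏ i : s, φ i (x i)
    have hdir : (Monotone Φj ∧ Monotone Φs) ∨ (Antitone Φj ∧ Antitone Φs) :=
      hφ.imp
        (fun h => ⟨fun x y hxy => h j (hxy _), fun x y hxy =>
          Finset.prod_le_prod (fun i _ => (hM i _).1) fun i _ => h i (hxy i)⟩)
        fun h => ⟨fun x y hxy => h j (hxy _), fun x y hxy =>
          Finset.prod_le_prod (fun i _ => (hM i _).1) fun i _ => h i (hxy i)⟩
    have hcov := hT {j} s (Finset.disjoint_singleton_left.2 hj) Φj Φs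
      ((hφm j).comp (measurable_pi_apply _))
      (Finset.measurable_prod _ fun i _ => (hφm i).comp (measurable_pi_apply _)) hdir
    have hΦs (ω) : Φs (fun i => T i ω) = ∏ i ∈ s, φ i (T i ω) :=
      Finset.prod_coe_sort s fun i => φ i (T i ω)
    simp only [Φj, hΦs] at hcov
    have hmul := hcov (hj2.integrable one_le_two) (hs2.integrable one_le_two)
      (hj2.integrable_mul hs2)
    rw [covariance_eq_sub hj2 hs2, sub_nonpos] at hmul
    simp only [Finset.prod_insert hj]
    exact hmul.trans (mul_le_mul_of_nonneg_left ih (integral_nonneg fun ω => (hM j _).1))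

/-- `ψ i (t, y)` has a common direction of monotonicity in `t` for all `i` and `y`, and a common
(possibly different) one in `y` for all `i` and `t`. -/
structure CoordMonotone {ι : Type*} (ψ : ι → ℝ × ℝ → ℝ) : Prop where
  left : SameDirection fun (p : ι × ℝ) t => ψ p.1 (t, p.2)
  right : SameDirection fun (p : ι × ℝ) y => ψ p.1 (p.2, y)

theorem CoordMonotone.comp {ι : Type*} {g : ι → ℝ → ℝ} {ψ : ι → ℝ × ℝ → ℝ}
    (hψ : CoordMonotone ψ) (hg : SameDirection g) : CoordMonotone fun i => g i ∘ ψ i where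
  left := (hg.reindex Prod.fst).comp hψ.left
  right := (hg.reindex Prod.fst).comp hψ.right

theorem integral_comp_of_indepFun {E E' : Type*} [MeasurableSpace E] [MeasurableSpace E']
    {U : Ω → E} {V : Ω → E'} (hU : Measurable U) (hV : Measurable V) (hUV : IndepFun U V μ)
    {Φ : E × E' → ℝ} (hΦ : Measurable Φ) (hint : Integrable (fun ω => Φ (U ω, V ω)) μ) :
    ∫ ω, Φ (U ω, V ω) ∂μ = ∫ ω, ∫ ω', Φ (U ω', V ω) ∂μ ∂μ := by
  have := Measure.isProbabilityMeasure_map (μ := μ) hU.aemeasurable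
  have := Measure.isProbabilityMeasure_map (μ := μ) hV.aemeasurable
  have hlaw := (indepFun_iff_map_prod_eq_prod_map_map hU.aemeasurable hV.aemeasurable).1 hUV
  have hint' : Integrable Φ ((μ.map U).prod (μ.map V)) := by
    rwa [← hlaw, integrable_map_measure hΦ.aestronglyMeasurable (hU.prodMk hV).aemeasurable]
  calc ∫ ω, Φ (U ω, V ω) ∂μ = ∫ z, Φ z ∂(μ.map U).prod (μ.map V) := by
        rw [← hlaw, integral_map (hU.prodMk hV).aemeasurable hΦ.aestronglyMeasurable]
    _ = ∫ ω, ∫ u, Φ (u, V ω) ∂μ.map U ∂μ := by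
        rw [integral_prod_symm Φ hint', integral_map hV.aemeasurable]
        exact hΦ.stronglyMeasurable.integral_prod_left'.aestronglyMeasurable
    _ = ∫ ω, ∫ ω', Φ (U ω', V ω) ∂μ ∂μ := by
        refine integral_congr_ae (ae_of_all _ fun ω => ?_)
        exact integral_map hU.aemeasurable
          (hΦ.comp measurable_prodMk_right).aestronglyMeasurable

/-- Two sequences of measurable random variables, each negatively associated, that are independent
of each other. -/
structure IndepNAPair (μ : Measure Ω) (T Y : ℕ → Ω → ℝ) : Prop where
  left_na : NegAssociated μ T
  right_na : NegAssociated μ Y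
  left_meas : ∀ i, Measurable (T i)
  right_meas : ∀ i, Measurable (Y i)
  indep : IndepFun (fun ω i => T i ω) (fun ω i => Y i ω) μ

section PartialMean

variable {U : ℕ → Ω → ℝ} {ψ : ℕ → ℝ × ℝ → ℝ} {M : ℝ}

theorem integrable_section (hU : ∀ i, Measurable (U i)) (hψ : CoordMonotone ψ)
    (hM : ∀ i z, ψ i z ∈ Set.Icc 0 M) (i : ℕ) (y : ℝ) :
    Integrable (fun ω => ψ i (U i ω, y)) μ :=
  .of_mem_Icc 0 M ((hψ.left.measurable (i, y)).comp (hU i)).aemeasurable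
    (ae_of_all _ fun _ => hM i _)

theorem partialMean_mem_Icc (hU : ∀ i, Measurable (U i)) (hψ : CoordMonotone ψ)
    (hM : ∀ i z, ψ i z ∈ Set.Icc 0 M) (i : ℕ) (y : ℝ) :
    ∫ ω, ψ i (U i ω, y) ∂μ ∈ Set.Icc 0 M :=
  ⟨integral_nonneg fun _ => (hM i _).1, by
    simpa using integral_mono (integrable_section (μ := μ) hU hψ hM i y) (integrable_const M)
      fun _ => (hM i _).2⟩

theorem sameDirection_partialMean (hU : ∀ i, Measurable (U i)) (hψ : CoordMonotone ψ)
    (hM : ∀ i z, ψ i z ∈ Set.Icc 0 M) : SameDirection fun i y => ∫ ω, ψ i (U i ω, y) ∂μ :=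
  have hint (i y) : Integrable (fun ω => ψ i (U i ω, y)) μ := integrable_section hU hψ hM i y
  hψ.right.imp
    (fun h i _ _ hy => integral_mono (hint i _) (hint i _) fun ω => h (i, U i ω) hy)
    fun h i _ _ hy => integral_mono (hint i _) (hint i _) fun ω => h (i, U i ω) hy

end PartialMean

theorem IndepNAPair.integral_eq_integral_partialMean (hp : IndepNAPair μ T Y) (i : ℕ)
    {ψ : ℝ × ℝ → ℝ} (hψm : Measurable ψ) {M : ℝ} (hM : ∀ z, ψ z ∈ Set.Icc 0 M) :
    ∫ ω, ψ (T i ω, Y i ω) ∂μ = ∫ ω, ∫ ω', ψ (T i ω', Y i ω) ∂μ ∂μ :=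
  integral_comp_of_indepFun (hp.left_meas i) (hp.right_meas i)
    (hp.indep.comp (measurable_pi_apply i) (measurable_pi_apply i)) hψm
    (.of_mem_Icc 0 M (hψm.comp ((hp.left_meas i).prodMk (hp.right_meas i))).aemeasurable
      (ae_of_all _ fun _ => hM _))

theorem IndepNAPair.integral_prod_le (hp : IndepNAPair μ T Y) {ψ : ℕ → ℝ × ℝ → ℝ}
    (hψm : ∀ i, Measurable (ψ i)) (hψ : CoordMonotone ψ) {M : ℝ}
    (hM : ∀ i z, ψ i z ∈ Set.Icc 0 M) (s : Finset ℕ) :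
    ∫ ω, ∏ i ∈ s, ψ i (T i ω, Y i ω) ∂μ ≤ ∏ i ∈ s, ∫ ω, ψ i (T i ω, Y i ω) ∂μ := by
  have hTm := measurable_pi_lambda (fun ω i => T i ω) hp.left_meas
  have hYm := measurable_pi_lambda (fun ω i => Y i ω) hp.right_meas
  have hmean := sameDirection_partialMean (μ := μ) hp.left_meas hψ hM
  have hmeanM := partialMean_mem_Icc (μ := μ) hp.left_meas hψ hM
  let Φ (z : (ℕ → ℝ) × (ℕ → ℝ)) : ℝ := ∏ i ∈ s, ψ i (z.1 i, z.2 i)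
  have hΦ : Measurable Φ := Finset.measurable_prod s fun i _ => (hψm i).comp (by fun_prop)
  have hΦM (z) : Φ z ∈ Set.Icc 0 (M ^ s.card) := prod_mem_Icc_pow (fun i => hM i _) s
  calc ∫ ω, ∏ i ∈ s, ψ i (T i ω, Y i ω) ∂μ
      = ∫ ω, ∫ ω', ∏ i ∈ s, ψ i (T i ω', Y i ω) ∂μ ∂μ :=
        integral_comp_of_indepFun hTm hYm hp.indep hΦ
          (.of_mem_Icc 0 (M ^ s.card) (hΦ.comp (hTm.prodMk hYm)).aemeasurable
            (ae_of_all _ fun _ => hΦM _))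
    _ ≤ ∫ ω, ∏ i ∈ s, ∫ ω', ψ i (T i ω', Y i ω) ∂μ ∂μ := by
        refine integral_mono_of_nonneg
          (ae_of_all _ fun ω => integral_nonneg fun ω' => (hΦM (_, _)).1)
          (.of_mem_Icc 0 (M ^ s.card) (Finset.measurable_prod s fun i _ =>
              (hmean.measurable i).comp (hp.right_meas i)).aemeasurable
            (ae_of_all _ fun ω => prod_mem_Icc_pow (fun i => hmeanM i _) s))
          (ae_of_all _ fun ω => ?_)
        exact hp.left_na.integral_prod_le hp.left_meas
          (hψ.left.reindex fun i => (i, Y i ω)) (fun i _ => hM i _) s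
    _ ≤ ∏ i ∈ s, ∫ ω, ∫ ω', ψ i (T i ω', Y i ω) ∂μ ∂μ :=
        hp.right_na.integral_prod_le hp.right_meas hmean hmeanM s
    _ = ∏ i ∈ s, ∫ ω, ψ i (T i ω, Y i ω) ∂μ :=
        Finset.prod_congr rfl fun i _ =>
          (hp.integral_eq_integral_partialMean i (hψm i) (hM i)).symm

end NegativeAssociation

section EmpiricalMeasure

/-- The empirical measure `n⁻¹ ∑_{i < n} δ_{z i}` of the first `n` terms of a sequence; it is the
zero measure for `n = 0`. -/
noncomputable def empiricalMeasure {E : Type*} [MeasurableSpace E] (z : ℕ → E) (n : ℕ) :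
    Measure E :=
  (n : ENNReal)⁻¹ • ∑ i ∈ Finset.range n, Measure.dirac (z i)

variable {E : Type*} [MeasurableSpace E] {z : ℕ → E} {n : ℕ}

instance : IsZeroOrProbabilityMeasure (empiricalMeasure z n) where
  measure_univ := by
    rcases eq_or_ne n 0 with rfl | hn
    · simp [empiricalMeasure]
    · right
      simp [empiricalMeasure, ENNReal.inv_mul_cancel (Nat.cast_ne_zero.2 hn)]

theorem integral_empiricalMeasure {φ : E → ℝ} (hφ : Measurable φ) :
    ∫ x, φ x ∂empiricalMeasure z n = (n : ℝ)⁻¹ * ∑ i ∈ Finset.range n, φ (z i) := by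
  have hdirac (i) : Integrable φ (Measure.dirac (z i)) :=
    integrable_dirac' hφ.stronglyMeasurable (by simp)
  rw [empiricalMeasure, integral_smul_measure, integral_finsetSum_measure fun i _ => hdirac i]
  simp [integral_dirac' _ _ hφ.stronglyMeasurable]

theorem measureReal_empiricalMeasure {A : Set E} (hA : MeasurableSet A) :
    (empiricalMeasure z n).real A = (n : ℝ)⁻¹ * ∑ i ∈ Finset.range n, A.indicator 1 (z i) := by
  rw [← integral_indicator_one hA, integral_empiricalMeasure (measurable_one.indicator hA)]

end EmpiricalMeasure

section Concentration

variable {Ω : Type*} [MeasurableSpace Ω] {μ : Measure Ω}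

theorem hasSubgaussianMGF_sum_of_mgf_sum_le {ι : Type*} {X : ι → Ω → ℝ} {c : ι → NNReal}
    {s : Finset ι} (hX : ∀ i ∈ s, HasSubgaussianMGF (X i) (c i) μ)
    (hint : ∀ t, Integrable (fun ω => Real.exp (t * ∑ i ∈ s, X i ω)) μ)
    (hmgf : ∀ t, mgf (fun ω => ∑ i ∈ s, X i ω) μ t ≤ ∏ i ∈ s, mgf (X i) μ t) :
    HasSubgaussianMGF (fun ω => ∑ i ∈ s, X i ω) (∑ i ∈ s, c i) μ where
  integrable_exp_mul := hint
  mgf_le t :=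
    calc mgf (fun ω => ∑ i ∈ s, X i ω) μ t ≤ ∏ i ∈ s, mgf (X i) μ t := hmgf t
      _ ≤ ∏ i ∈ s, Real.exp (c i * t ^ 2 / 2) :=
          Finset.prod_le_prod (fun _ _ => mgf_nonneg) fun i hi => (hX i hi).mgf_le t
      _ = Real.exp ((∑ i ∈ s, c i : NNReal) * t ^ 2 / 2) := by
          rw [← Real.exp_sum, NNReal.coe_sum, Finset.sum_mul, Finset.sum_div]

theorem measureReal_le_abs_le_of_hasSubgaussianMGF [IsFiniteMeasure μ] {X : Ω → ℝ} {c : NNReal}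
    (hX : HasSubgaussianMGF X c μ) {ε : ℝ} (hε : 0 ≤ ε) :
    μ.real {ω | ε ≤ |X ω|} ≤ 2 * Real.exp (-ε ^ 2 / (2 * c)) := by
  have hsplit : {ω | ε ≤ |X ω|} ⊆ {ω | ε ≤ X ω} ∪ {ω | ε ≤ (-X) ω} := 
    fun ω (hω : ε ≤ |X ω|) => (le_abs.1 hω : ε ≤ X ω ∨ ε ≤ -X ω)
  calc μ.real {ω | ε ≤ |X ω|} ≤ μ.real {ω | ε ≤ X ω} + μ.real {ω | ε ≤ (-X) ω} :=
        (measureReal_mono hsplit).trans (measureReal_union_le _ _)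
    _ ≤ 2 * Real.exp (-ε ^ 2 / (2 * c)) := by
        rw [two_mul]
        exact add_le_add (hX.measure_ge_le hε) (hX.neg.measure_ge_le hε)

theorem sameDirection_exp_mul_sub {ι : Type*} (t : ℝ) (m : ι → ℝ) :
    SameDirection fun i v => Real.exp (t * (v - m i)) := by
  rcases le_total 0 t with ht | ht
  · exact .inl fun i u v huv =>
      Real.exp_le_exp.2 (mul_le_mul_of_nonneg_left (sub_le_sub_right huv _) ht)
  · exact .inr fun i u v huv =>
      Real.exp_le_exp.2 (mul_le_mul_of_nonpos_left (sub_le_sub_right huv _) ht)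

variable {T Y : ℕ → Ω → ℝ}

theorem IndepNAPair.measurable_pair (hp : IndepNAPair μ T Y) (i : ℕ) :
    Measurable fun ω => (T i ω, Y i ω) :=
  (hp.left_meas i).prodMk (hp.right_meas i)

variable [IsProbabilityMeasure μ]

theorem integral_mem_Icc {X : Ω → ℝ} {c d : ℝ} (hX : Measurable X)
    (hcd : ∀ ω, X ω ∈ Set.Icc c d) : ∫ ω, X ω ∂μ ∈ Set.Icc c d := by
  have hint : Integrable X μ := .of_mem_Icc c d hX.aemeasurable (ae_of_all _ hcd)
  constructor
  · simpa using integral_mono (integrable_const c) hint fun ω => (hcd ω).1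
  · simpa using integral_mono hint (integrable_const d) fun ω => (hcd ω).2

theorem IndepNAPair.hasSubgaussianMGF_sum (hp : IndepNAPair μ T Y) {ξ : ℕ → ℝ × ℝ → ℝ}
    (hξm : ∀ i, Measurable (ξ i)) (hξ : CoordMonotone ξ) {c d : ℝ}
    (hcd : ∀ i z, ξ i z ∈ Set.Icc c d) (s : Finset ℕ) :
    HasSubgaussianMGF
      (fun ω => ∑ i ∈ s, (ξ i (T i ω, Y i ω) - ∫ ω', ξ i (T i ω', Y i ω') ∂μ))
      (∑ _i ∈ s, (‖d - c‖₊ / 2) ^ 2) μ := by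
  have hm (i) : Measurable fun ω => ξ i (T i ω, Y i ω) := (hξm i).comp (hp.measurable_pair i)
  let m (i : ℕ) : ℝ := ∫ ω, ξ i (T i ω, Y i ω) ∂μ
  have hmem (i) : m i ∈ Set.Icc c d := integral_mem_Icc (hm i) fun ω => hcd i _
  refine hasSubgaussianMGF_sum_of_mgf_sum_le
    (fun i _ => hasSubgaussianMGF_of_mem_Icc (hm i).aemeasurable (ae_of_all _ fun ω => hcd i _))
    (fun t => ?_) fun t => ?_
  · refine integrable_exp_mul_of_mem_Icc (a := ∑ i ∈ s, (c - m i)) (b := ∑ i ∈ s, (d - m i))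
      (Finset.measurable_sum s fun i _ => (hm i).sub_const _).aemeasurable
      (ae_of_all _ fun ω => ⟨?_, ?_⟩)
    · exact Finset.sum_le_sum fun i _ => sub_le_sub_right (hcd i _).1 _
    · exact Finset.sum_le_sum fun i _ => sub_le_sub_right (hcd i _).2 _
  · let ψ (i : ℕ) (z : ℝ × ℝ) : ℝ := Real.exp (t * (ξ i z - m i))
    have hψM (i z) : ψ i z ∈ Set.Icc 0 (Real.exp (|t| * (d - c))) := by
      refine ⟨(Real.exp_pos _).le, Real.exp_le_exp.2 ((le_abs_self _).trans ?_)⟩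
      rw [abs_mul]
      exact mul_le_mul_of_nonneg_left
        (abs_sub_le_of_le_of_le (hcd i z).1 (hcd i z).2 (hmem i).1 (hmem i).2) (abs_nonneg t)
    have hprod := hp.integral_prod_le (ψ := ψ)
      (fun i => (((hξm i).sub_const _).const_mul t).exp)
      (hξ.comp (sameDirection_exp_mul_sub t m)) hψM s
    simpa only [mgf, Finset.mul_sum, Real.exp_sum] using hprod

theorem IndepNAPair.measureReal_lt_abs_empiricalMeasure_sub_le (hp : IndepNAPair μ T Y)
    {P : Measure (ℝ × ℝ)} (hP : ∀ i, μ.map (fun ω => (T i ω, Y i ω)) = P) {A : Set (ℝ × ℝ)}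
    (hAm : MeasurableSet A) (hA : CoordMonotone fun _ : ℕ => A.indicator (1 : ℝ × ℝ → ℝ))
    {n : ℕ} (hn : n ≠ 0) {ε : ℝ} (hε : 0 ≤ ε) :
    μ.real {ω | ε < |(empiricalMeasure (fun i => (T i ω, Y i ω)) n).real A - P.real A|} ≤
      2 * Real.exp (-2 * n * ε ^ 2) := by
  have hn' : (0 : ℝ) < n := by positivity
  have hAm1 : Measurable (A.indicator (1 : ℝ × ℝ → ℝ)) := measurable_one.indicator hAm
  have hmean (i) : ∫ ω, A.indicator (1 : ℝ × ℝ → ℝ) (T i ω, Y i ω) ∂μ = P.real A := by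
    rw [← integral_map (hp.measurable_pair i).aemeasurable hAm1.aestronglyMeasurable, hP i,
      integral_indicator_one hAm]
  have hsub := hp.hasSubgaussianMGF_sum (fun _ => hAm1) hA (c := 0) (d := 1)
    (fun _ z => ⟨Set.indicator_nonneg (fun _ _ => zero_le_one) z,
      Set.indicator_le_self' (fun _ _ => zero_le_one) z⟩) (Finset.range n)
  have htail := measureReal_le_abs_le_of_hasSubgaussianMGF hsub
    (mul_nonneg hn'.le hε)
  refine (measureReal_mono fun ω hω => ?_).trans (htail.trans_eq ?_)
  · have hω' : ε < |_| := hω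
    rw [measureReal_empiricalMeasure hAm] at hω'
    simp only [Set.mem_ofPred_eq, hmean, Finset.sum_sub_distrib, Finset.sum_const,
      Finset.card_range, nsmul_eq_mul]
    rw [← mul_inv_cancel_left₀ hn'.ne' (∑ _ ∈ _, _), ← mul_sub, abs_mul, abs_of_pos hn']
    exact mul_le_mul_of_nonneg_left hω'.le hn'.le
  · congr 2
    simp only [sub_zero, nnnorm_one, Finset.sum_const, Finset.card_range, nsmul_eq_mul]
    push_cast
    field

end Concentration

section KolmogorovRate

variable {Ω : Type*} [MeasurableSpace Ω] {μ : Measure Ω} [IsFiniteMeasure μ]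
  {α : Type*} [LinearOrder α] [TopologicalSpace α] [OrderTopology α] [MeasurableSpace α]
  [BorelSpace α] {ν : Measure α} [IsFiniteMeasure ν] [ν.InnerRegularCompactLTTop]

theorem measureReal_not_kolmogorovClose_le (hν : ν.real Set.univ ≤ 1) {ν' : Ω → Measure α}
    [∀ ω, IsFiniteMeasure (ν' ω)] {ε p : ℝ}
    (hp : ∀ S, IsLowerSet S → μ.real {ω | ε < |(ν' ω).real S - ν.real S|} ≤ p) {m : ℕ}
    (hm : m ≠ 0) :
    μ.real {ω | ¬ KolmogorovClose (ν' ω) ν (ε + 1 / m)} ≤ (m + 2) * (2 * p) := by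
  let dev (S : Set α) : Set Ω := {ω | ε < |(ν' ω).real S - ν.real S|}
  let bad (j : ℕ) : Set Ω := dev (upperQuantileSet ν (j / m)) ∪ dev (lowerQuantileSet ν (j / m))
  have hcover : {ω | ¬ KolmogorovClose (ν' ω) ν (ε + 1 / m)} ⊆
      ⋃ j ∈ Finset.range (m + 2), bad j := by
    intro ω hω
    by_contra hgood
    simp only [Set.mem_iUnion, not_exists] at hgood
    exact hω (kolmogorovClose_of_forall_quantileSet hν hm
      (fun j hj => not_lt.1 fun h => hgood j hj (.inl h))
      fun j hj => not_lt.1 fun h => hgood j hj (.inr h))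
  calc μ.real {ω | ¬ KolmogorovClose (ν' ω) ν (ε + 1 / m)}
      ≤ ∑ j ∈ Finset.range (m + 2), μ.real (bad j) :=
        (measureReal_mono hcover (measure_ne_top _ _)).trans (measureReal_biUnion_finset_le _ _)
    _ ≤ ∑ _j ∈ Finset.range (m + 2), 2 * p := Finset.sum_le_sum fun j _ => by
        rw [two_mul]
        exact (measureReal_union_le _ _).trans
          (add_le_add (hp _ isLowerSet_upperQuantileSet) (hp _ isLowerSet_lowerQuantileSet))
    _ = (m + 2) * (2 * p) := by simp

theorem exp_neg_two_mul_sq_sqrt_log_div {n : ℕ} (hn : n ≠ 0) :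
    Real.exp (-2 * n * (2 * Real.sqrt (Real.log n / n)) ^ 2) = ((n : ℝ) ^ 8)⁻¹ := by
  have hlog : 0 ≤ Real.log n / n := div_nonneg (Real.log_natCast_nonneg n) (Nat.cast_nonneg n)
  have hn_pos : (0 : ℝ) < n := by positivity
  have hexp : -2 * n * (2 * Real.sqrt (Real.log n / n)) ^ 2 = -Real.log ((n : ℝ) ^ 8) := by
    rw [mul_pow, Real.sq_sqrt hlog, Real.log_pow]
    push_cast
    field
  rw [hexp, Real.exp_neg, Real.exp_log (pow_pos hn_pos 8)]

theorem eventually_one_div_le_sqrt_log_div :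
    ∀ᶠ n : ℕ in atTop, 1 / (n : ℝ) ≤ Real.sqrt (Real.log n / n) := by
  filter_upwards [eventually_ge_atTop 3] with n hn
  have hn3 : (3 : ℝ) ≤ n := by exact_mod_cast hn
  have hpos : (0 : ℝ) < n := by linarith
  have hlog : 1 ≤ Real.log n := by
    rw [Real.le_log_iff_exp_le hpos]
    linarith [Real.exp_one_lt_three]
  refine Real.le_sqrt_of_sq_le ?_
  rw [one_div, inv_pow, ← one_div, div_le_div_iff₀ (by positivity) hpos]
  nlinarith

theorem ae_eventually_kolmogorovClose_of_tail_le (hν : ν.real Set.univ ≤ 1)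
    {ν' : ℕ → Ω → Measure α} [∀ n ω, IsFiniteMeasure (ν' n ω)]
    (htail : ∀ S, IsLowerSet S → ∀ n ≠ 0, ∀ ε ≥ 0,
      μ.real {ω | ε < |(ν' n ω).real S - ν.real S|} ≤ 2 * Real.exp (-2 * n * ε ^ 2)) :
    ∀ᵐ ω ∂μ, ∀ᶠ n : ℕ in atTop, KolmogorovClose (ν' n ω) ν (3 * Real.sqrt (Real.log n / n)) := by
  let ε (n : ℕ) : ℝ := 2 * Real.sqrt (Real.log n / n)
  let bad (n : ℕ) : Set Ω := {ω | n ≠ 0 ∧ ¬ KolmogorovClose (ν' n ω) ν (ε n + 1 / n)}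
  have hbad (n : ℕ) : μ (bad n) ≤ ENNReal.ofReal (12 * (1 / (n : ℝ) ^ 2)) := by
    rcases eq_or_ne n 0 with rfl | hn
    · simp [bad]
    have hn1 : (1 : ℝ) ≤ n := by exact_mod_cast Nat.one_le_iff_ne_zero.2 hn
    have hle := measureReal_not_kolmogorovClose_le hν (fun S hS =>
      (htail S hS n hn (ε n) (by positivity)).trans_eq
        (congrArg (2 * ·) (exp_neg_two_mul_sq_sqrt_log_div hn))) hn
    rw [ENNReal.le_ofReal_iff_toReal_le (measure_ne_top _ _) (by positivity)]
    calc μ.real (bad n) ≤ (n + 2) * (2 * (2 * ((n : ℝ) ^ 8)⁻¹)) :=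
          (measureReal_mono fun ω hω => hω.2).trans hle
      _ ≤ 3 * (n : ℝ) ^ 6 * (2 * (2 * ((n : ℝ) ^ 8)⁻¹)) := by
          gcongr
          linarith [le_self_pow₀ hn1 (show 6 ≠ 0 by norm_num)]
      _ = 12 * (1 / (n : ℝ) ^ 2) := by field
  have hsum : ∑' n, μ (bad n) ≠ ⊤ :=
    ne_top_of_le_ne_top
      ((Real.summable_one_div_nat_pow.2 one_lt_two).mul_left 12).tsum_ofReal_ne_top
      (ENNReal.tsum_le_tsum hbad)
  filter_upwards [ae_eventually_notMem hsum] with ω hω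
  filter_upwards [hω, eventually_ne_atTop 0, eventually_one_div_le_sqrt_log_div]
    with n hgood hn hle S hS
  have hclose : KolmogorovClose (ν' n ω) ν (ε n + 1 / n) := by_contra fun h => hgood ⟨hn, h⟩
  exact (hclose S hS).trans (by simp only [ε]; linarith)

end KolmogorovRate

section SubLaw

/-- The law of `ζ` under `P` restricted to the event `D`, a sub-distribution when `P` is a
probability measure. -/
noncomputable def subLaw {E α : Type*} [MeasurableSpace E] [MeasurableSpace α] (D : Set E)
    (ζ : E → α) (P : Measure E) : Measure α :=
  (P.restrict D).map ζ

variable {E α : Type*} [MeasurableSpace E] [MeasurableSpace α] {D : Set E} {ζ : E → α}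
  {P : Measure E}

instance [IsFiniteMeasure P] : IsFiniteMeasure (subLaw D ζ P) := by
  unfold subLaw
  infer_instance

theorem measureReal_subLaw (hD : MeasurableSet D) (hζ : Measurable ζ) {S : Set α}
    (hS : MeasurableSet S) : (subLaw D ζ P).real S = P.real (D ∩ ζ ⁻¹' S) := by
  rw [subLaw, map_measureReal_apply hζ hS, measureReal_restrict_apply' hD, Set.inter_comm]

theorem measureReal_subLaw_univ_le_one [IsZeroOrProbabilityMeasure P] (hD : MeasurableSet D)
    (hζ : Measurable ζ) : (subLaw D ζ P).real Set.univ ≤ 1 := by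
  rw [measureReal_subLaw hD hζ .univ]
  exact measureReal_le_one

theorem integral_subLaw (hD : MeasurableSet D) (hζ : Measurable ζ) {φ : α → ℝ}
    (hφ : Measurable φ) : ∫ x, φ x ∂subLaw D ζ P = ∫ z, D.indicator (φ ∘ ζ) z ∂P := by
  rw [subLaw, integral_map hζ.aemeasurable hφ.aestronglyMeasurable, ← integral_indicator hD]
  rfl

end SubLaw

section EmpiricalProcess

variable {Ω : Type*} [MeasurableSpace Ω] {μ : Measure Ω}

theorem integral_integral_empiricalMeasure {E : Type*} [MeasurableSpace E] {P : Measure E}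
    {z : ℕ → Ω → E} (hz : ∀ i, Measurable (z i))
    (hP : ∀ i, μ.map (z i) = P) {φ : E → ℝ} (hφm : Measurable φ) (hφ : Integrable φ P) {n : ℕ}
    (hn : n ≠ 0) : ∫ ω, ∫ x, φ x ∂empiricalMeasure (z · ω) n ∂μ = ∫ x, φ x ∂P := by
  have hint (i) : Integrable (fun ω => φ (z i ω)) μ :=
    (integrable_map_measure hφm.aestronglyMeasurable (hz i).aemeasurable).1 (by rwa [hP i])
  have hmean (i) : ∫ ω, φ (z i ω) ∂μ = ∫ x, φ x ∂P := by
    rw [← hP i, integral_map (hz i).aemeasurable hφm.aestronglyMeasurable]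
  simp only [integral_empiricalMeasure hφm, integral_const_mul]
  rw [integral_finsetSum _ fun i _ => hint i]
  simp only [hmean, Finset.sum_const, Finset.card_range, nsmul_eq_mul]
  exact inv_mul_cancel_left₀ (Nat.cast_ne_zero.2 hn) _

theorem IndepNAPair.ae_eventually_kolmogorovClose [IsProbabilityMeasure μ] {T Y : ℕ → Ω → ℝ}
    (hp : IndepNAPair μ T Y) {P : Measure (ℝ × ℝ)} [IsProbabilityMeasure P]
    (hP : ∀ i, μ.map (fun ω => (T i ω, Y i ω)) = P) {D : Set (ℝ × ℝ)} {ζ : ℝ × ℝ → ℝ}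
    (hD : MeasurableSet D) (hζ : Measurable ζ)
    (hDζ : ∀ S, IsLowerSet S →
      CoordMonotone fun _ : ℕ => (D ∩ ζ ⁻¹' S).indicator (1 : ℝ × ℝ → ℝ)) :
    ∀ᵐ ω ∂μ, ∀ᶠ n : ℕ in atTop,
      KolmogorovClose (subLaw D ζ (empiricalMeasure (fun i => (T i ω, Y i ω)) n))
        (subLaw D ζ P) (3 * Real.sqrt (Real.log n / n)) := by
  refine ae_eventually_kolmogorovClose_of_tail_le (measureReal_subLaw_univ_le_one hD hζ)
    fun S hS n hn ε hε => ?_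
  have hSm := measurableSet_of_isLowerSet hS
  simp only [measureReal_subLaw hD hζ hSm]
  exact hp.measureReal_lt_abs_empiricalMeasure_sub_le hP (hD.inter (hζ hSm)) (hDζ S hS) hn hε

end EmpiricalProcess

section Censoring

/-- The pairs (survival time, censoring time) whose survival time is observed. -/
def uncensored : Set (ℝ × ℝ) := {z | z.1 ≤ z.2}

theorem measurableSet_uncensored : MeasurableSet uncensored :=
  measurableSet_le measurable_fst measurable_snd

/-- The observed time of a pair (survival time, censoring time). -/
def minPair (z : ℝ × ℝ) : ℝ := min z.1 z.2

theorem measurable_minPair : Measurable minPair := measurable_fst.min measurable_snd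

theorem antitone_indicator_one_of_isLowerSet {α : Type*} [Preorder α] {S : Set α}
    (hS : IsLowerSet S) : Antitone (S.indicator (1 : α → ℝ)) := fun x y hxy => by
  by_cases hy : y ∈ S
  · simp [hy, hS hxy hy]
  · rw [Set.indicator_of_notMem hy]
    exact Set.indicator_nonneg (fun _ _ => zero_le_one) x

theorem monotone_indicator_one_of_isUpperSet {α : Type*} [Preorder α] {S : Set α}
    (hS : IsUpperSet S) : Monotone (S.indicator (1 : α → ℝ)) :=
  (antitone_indicator_one_of_isLowerSet hS.toDual).dual_left

theorem coordMonotone_indicator {ι : Type*} {A : Set (ℝ × ℝ)}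
    (hleft : ∀ y, IsLowerSet {t | (t, y) ∈ A})
    (hright : (∀ t, IsUpperSet {y | (t, y) ∈ A}) ∨ ∀ t, IsLowerSet {y | (t, y) ∈ A}) :
    CoordMonotone fun _ : ι => A.indicator (1 : ℝ × ℝ → ℝ) where
  left := .inr fun p => antitone_indicator_one_of_isLowerSet (hleft p.2)
  right := hright.imp (fun h p => monotone_indicator_one_of_isUpperSet (h p.2))
    fun h p => antitone_indicator_one_of_isLowerSet (h p.2)

variable {ι : Type*} {S : Set ℝ}

theorem coordMonotone_indicator_uncensored (hS : IsLowerSet S) :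
    CoordMonotone fun _ : ι => (uncensored ∩ Prod.fst ⁻¹' S).indicator (1 : ℝ × ℝ → ℝ) :=
  coordMonotone_indicator (fun _ _ _ h hz => ⟨h.trans hz.1, hS h hz.2⟩)
    (.inl fun _ _ _ h hz => ⟨le_trans hz.1 h, hz.2⟩)

theorem coordMonotone_indicator_minPair (hS : IsLowerSet S) :
    CoordMonotone fun _ : ι => (Set.univ ∩ minPair ⁻¹' S).indicator (1 : ℝ × ℝ → ℝ) :=
  coordMonotone_indicator (fun y _ _ h hz => ⟨trivial, hS (min_le_min_right y h) hz.2⟩)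
    (.inr fun t _ _ h hz => ⟨trivial, hS (min_le_min_left t h) hz.2⟩)

theorem coordMonotone_indicator_fst (hS : IsLowerSet S) :
    CoordMonotone fun _ : ι => (Set.univ ∩ Prod.fst ⁻¹' S).indicator (1 : ℝ × ℝ → ℝ) :=
  coordMonotone_indicator (fun _ _ _ h hz => ⟨trivial, hS h hz.2⟩) (.inl fun _ _ _ _ hz => hz)

end Censoring

section KernelIntegrals

variable {α : Type*}

/-- `κ` vanishes off the interval `J`, where it is a difference of two increasing functions with
values in `[0, C]`. This is bounded variation in the form in which it is used on integrands: it is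
stable under the operations leading from the smoothing kernel to the integrand of the estimator. -/
structure MonotoneDifference [Preorder α] (κ : α → ℝ) (J : Set α) (C : ℝ) : Prop where
  ordConnected : J.OrdConnected
  nonneg : 0 ≤ C
  eq_zero : ∀ x ∉ J, κ x = 0
  exists_eq_sub : ∃ P Q : α → ℝ, MonotoneOn P J ∧ MonotoneOn Q J ∧
    Set.MapsTo P J (Set.Icc 0 C) ∧ Set.MapsTo Q J (Set.Icc 0 C) ∧ ∀ x ∈ J, κ x = P x - Q x

theorem abs_variationOnFromTo_le [LinearOrder α] {κ : α → ℝ} {J : Set α}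
    (hκ : BoundedVariationOn κ J) (c x : α) :
    |variationOnFromTo κ J c x| ≤ (eVariationOn κ J).toReal := by
  have hle (u v : α) : (eVariationOn κ (J ∩ Set.Icc u v)).toReal ≤ (eVariationOn κ J).toReal :=
    ENNReal.toReal_mono hκ (eVariationOn.mono _ Set.inter_subset_left)
  rw [variationOnFromTo]
  split_ifs
  · rw [abs_of_nonneg ENNReal.toReal_nonneg]
    exact hle c x
  · rw [abs_neg, abs_of_nonneg ENNReal.toReal_nonneg]
    exact hle x c

theorem exists_monotoneDifference [LinearOrder α] {κ : α → ℝ} {J : Set α} (hJ : J.OrdConnected)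
    (hκ : BoundedVariationOn κ J) (h0 : ∀ x ∉ J, κ x = 0) : ∃ C, MonotoneDifference κ J C := by
  rcases J.eq_empty_or_nonempty with rfl | ⟨c, hc⟩
  · exact ⟨0, hJ, le_rfl, h0, 0, 0, by simp [MonotoneOn, Set.MapsTo]⟩
  set V := (eVariationOn κ J).toReal
  set p := variationOnFromTo κ J c
  have hpV (x : α) : |p x| ≤ V := abs_variationOnFromTo_le hκ c x
  have hκV : ∀ x ∈ J, |κ x| ≤ |κ c| + V := fun x hx => by
    have hdist := hκ.dist_le hx hc
    rw [Real.dist_eq] at hdist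
    linarith [abs_sub_abs_le_abs_sub (κ x) (κ c)]
  have hV : 0 ≤ V := ENNReal.toReal_nonneg
  have hp : MonotoneOn p J := variationOnFromTo.monotoneOn hκ.locallyBoundedVariationOn hc
  have hq : MonotoneOn (p - κ) J :=
    variationOnFromTo.sub_self_monotoneOn hκ.locallyBoundedVariationOn hc
  refine ⟨2 * (|κ c| + 2 * V), hJ, by positivity, h0, fun x => |κ c| + 2 * V + p x,
    fun x => |κ c| + 2 * V + (p x - κ x), monotoneOn_const.add hp, monotoneOn_const.add hq,
    fun x _ => ?_, fun x hx => ?_, fun x _ => by ring⟩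
  · have hpx := abs_le.1 (hpV x)
    constructor <;> linarith [hpx.1, hpx.2, abs_nonneg (κ c)]
  · have hpx := abs_le.1 (hpV x)
    have hκx := abs_le.1 (hκV x hx)
    constructor <;> linarith [hpx.1, hpx.2, hκx.1, hκx.2]

theorem abs_one_div_sub_one_div_le {x y ε ℓ : ℝ} (hℓ : 0 < ℓ) (hy : ℓ ≤ y) (hx : ℓ / 2 ≤ x)
    (h : |x - y| ≤ ε) : |1 / x - 1 / y| ≤ 2 / ℓ ^ 2 * ε := by
  have hx0 : 0 < x := (half_pos hℓ).trans_le hx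
  have hy0 : 0 < y := hℓ.trans_le hy
  have hxy : ℓ / 2 * ℓ ≤ x * y := mul_le_mul hx hy hℓ.le hx0.le
  rw [div_sub_div _ _ hx0.ne' hy0.ne', one_mul, mul_one, abs_div, abs_sub_comm,
    abs_of_pos (mul_pos hx0 hy0)]
  calc |x - y| / (x * y) ≤ ε / (ℓ / 2 * ℓ) :=
        div_le_div₀ ((abs_nonneg _).trans h) h (by positivity) hxy
    _ = 2 / ℓ ^ 2 * ε := by field

namespace MonotoneDifference

section Preorder

variable [Preorder α] {κ : α → ℝ} {J : Set α} {C : ℝ}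

theorem abs_le (hκ : MonotoneDifference κ J C) (x : α) : |κ x| ≤ C := by
  obtain ⟨P, Q, -, -, hP, hQ, hPQ⟩ := hκ.exists_eq_sub
  by_cases hx : x ∈ J
  · rw [hPQ x hx]
    exact (Real.dist_le_of_mem_Icc (hP hx) (hQ hx)).trans_eq (sub_zero C)
  · rw [hκ.eq_zero x hx, abs_zero]
    exact hκ.nonneg

theorem comp_antitone {β : Type*} [Preorder β] (hκ : MonotoneDifference κ J C) {f : β → α}
    (hf : Antitone f) : MonotoneDifference (fun x => κ (f x)) (f ⁻¹' J) C := by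
  obtain ⟨P, Q, hPm, hQm, hP, hQ, hPQ⟩ := hκ.exists_eq_sub
  refine ⟨hκ.ordConnected.preimage_anti hf, hκ.nonneg, fun x hx => hκ.eq_zero _ hx,
    fun x => C - Q (f x), fun x => C - P (f x),
    fun x hx y hy hxy => sub_le_sub_left (hQm hy hx (hf hxy)) C,
    fun x hx y hy hxy => sub_le_sub_left (hPm hy hx (hf hxy)) C,
    fun x hx => ?_, fun x hx => ?_, fun x hx => ?_⟩
  · exact ⟨sub_nonneg.2 (hQ hx).2, sub_le_self C (hQ hx).1⟩
  · exact ⟨sub_nonneg.2 (hP hx).2, sub_le_self C (hP hx).1⟩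
  · rw [sub_sub_sub_cancel_left]
    exact hPQ _ hx

theorem indicator (hκ : MonotoneDifference κ J C) {S : Set α} (hS : S.OrdConnected) :
    MonotoneDifference (S.indicator κ) (S ∩ J) C := by
  obtain ⟨P, Q, hPm, hQm, hP, hQ, hPQ⟩ := hκ.exists_eq_sub
  have hsub : S ∩ J ⊆ J := Set.inter_subset_right
  refine ⟨hS.inter hκ.ordConnected, hκ.nonneg, fun x hx => ?_, P, Q, hPm.mono hsub,
    hQm.mono hsub, hP.mono_left hsub, hQ.mono_left hsub, fun x hx => ?_⟩
  · exact Set.indicator_apply_eq_zero.2 fun hxS => hκ.eq_zero x fun hxJ => hx ⟨hxS, hxJ⟩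
  · rw [Set.indicator_of_mem hx.1]
    exact hPQ x hx.2

theorem mul_monotoneOn (hκ : MonotoneDifference κ J C) {w : α → ℝ} (hw : MonotoneOn w J) {B : ℝ}
    (hB : 0 ≤ B) (hwB : Set.MapsTo w J (Set.Icc 0 B)) :
    MonotoneDifference (fun x => κ x * w x) J (C * B) := by
  have hmono {R : α → ℝ} (hR : MonotoneOn R J) (hRC : Set.MapsTo R J (Set.Icc 0 C)) :
      MonotoneOn (fun x => R x * w x) J :=
    hR.mul hw (fun _ hx => (hRC hx).1) fun _ hx => (hwB hx).1
  have hmaps {R : α → ℝ} (hRC : Set.MapsTo R J (Set.Icc 0 C)) :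
      Set.MapsTo (fun x => R x * w x) J (Set.Icc 0 (C * B)) := fun x hx =>
    ⟨mul_nonneg (hRC hx).1 (hwB hx).1,
      mul_le_mul (hRC hx).2 (hwB hx).2 (hwB hx).1 hκ.nonneg⟩
  obtain ⟨P, Q, hPm, hQm, hP, hQ, hPQ⟩ := hκ.exists_eq_sub
  refine ⟨hκ.ordConnected, mul_nonneg hκ.nonneg hB, fun x hx => ?_, fun x => P x * w x,
    fun x => Q x * w x, hmono hPm hP, hmono hQm hQ, hmaps hP, hmaps hQ, fun x hx => ?_⟩
  · rw [hκ.eq_zero x hx, zero_mul]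
  · rw [hPQ x hx, sub_mul]

theorem mul_one_div_measureReal_Ici [MeasurableSpace α] (hκ : MonotoneDifference κ J C)
    {R : Measure α} [IsFiniteMeasure R] {ℓ : ℝ} (hℓ : 0 < ℓ)
    (hR : ∀ x ∈ J, ℓ ≤ R.real (Set.Ici x)) :
    MonotoneDifference (fun x => κ x * (1 / R.real (Set.Ici x))) J (C * (1 / ℓ)) :=
  hκ.mul_monotoneOn
    (fun _ _ y hy hxy => one_div_le_one_div_of_le (hℓ.trans_le (hR y hy))
      (measureReal_mono (Set.Ici_subset_Ici.2 hxy)))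
    (one_div_nonneg.2 hℓ.le)
    fun x hx => ⟨one_div_nonneg.2 measureReal_nonneg, one_div_le_one_div_of_le hℓ (hR x hx)⟩

end Preorder

variable [LinearOrder α] [TopologicalSpace α] [OrderTopology α] [MeasurableSpace α]
  [BorelSpace α] {κ : α → ℝ} {J : Set α} {C : ℝ}

theorem measurable (hκ : MonotoneDifference κ J C) : Measurable κ := by
  obtain ⟨P, Q, hPm, hQm, -, -, hPQ⟩ := hκ.exists_eq_sub
  have heq : κ = J.indicator P - J.indicator Q := by
    ext x
    by_cases hx : x ∈ J
    · simp [hx, hPQ x hx]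
    · simp [hx, hκ.eq_zero x hx]
  rw [heq]
  exact (measurable_indicator_of_monotoneOn hκ.ordConnected hPm).sub
    (measurable_indicator_of_monotoneOn hκ.ordConnected hQm)

theorem integrable (hκ : MonotoneDifference κ J C) (ν : Measure α) [IsFiniteMeasure ν] :
    Integrable κ ν :=
  .of_bound hκ.measurable.aestronglyMeasurable C (ae_of_all _ hκ.abs_le)

theorem abs_integral_sub_le (hκ : MonotoneDifference κ J C) {ν₁ ν₂ : Measure α}
    [IsFiniteMeasure ν₁] [IsFiniteMeasure ν₂] {δ : ℝ} (h : KolmogorovClose ν₁ ν₂ δ) :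
    |∫ x, κ x ∂ν₁ - ∫ x, κ x ∂ν₂| ≤ 4 * C * δ := by
  obtain ⟨P, Q, hPm, hQm, hP, hQ, hPQ⟩ := hκ.exists_eq_sub
  have hJ := hκ.ordConnected
  have hsplit (ν : Measure α) [IsFiniteMeasure ν] :
      ∫ x, κ x ∂ν = ∫ x in J, P x ∂ν - ∫ x in J, Q x ∂ν := by
    rw [← setIntegral_eq_integral_of_forall_compl_eq_zero hκ.eq_zero,
      setIntegral_congr_fun hJ.measurableSet hPQ]
    exact integral_sub (integrableOn_of_monotoneOn hJ hPm hP)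
      (integrableOn_of_monotoneOn hJ hQm hQ)
  calc |∫ x, κ x ∂ν₁ - ∫ x, κ x ∂ν₂|
      = |(∫ x in J, P x ∂ν₁ - ∫ x in J, P x ∂ν₂) - (∫ x in J, Q x ∂ν₁ - ∫ x in J, Q x ∂ν₂)| := by
        rw [hsplit ν₁, hsplit ν₂, sub_sub_sub_comm]
    _ ≤ 2 * C * δ + 2 * C * δ := (abs_sub _ _).trans (add_le_add
        (h.abs_setIntegral_sub_le_of_monotoneOn hJ hPm hκ.nonneg hP)
        (h.abs_setIntegral_sub_le_of_monotoneOn hJ hQm hκ.nonneg hQ))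
    _ = 4 * C * δ := by ring

theorem abs_integral_mul_one_div_sub_le (hκ : MonotoneDifference κ J C) {ν ν' R R' : Measure α}
    [IsFiniteMeasure ν] [IsFiniteMeasure ν'] [IsFiniteMeasure R] [IsFiniteMeasure R']
    {δ : ℝ} (hν : KolmogorovClose ν' ν δ) (hR : KolmogorovClose R' R δ)
    (hν' : ν'.real Set.univ ≤ 1) {ℓ : ℝ} (hℓ : 0 < ℓ) (hδ : 4 * δ ≤ ℓ)
    (hRJ : ∀ x ∈ J, ℓ ≤ R.real (Set.Ici x)) :
    |∫ x, κ x * (1 / R'.real (Set.Ici x)) ∂ν' - ∫ x, κ x * (1 / R.real (Set.Ici x)) ∂ν| ≤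
      (4 * C / ℓ ^ 2 + 4 * C / ℓ) * δ := by
  have hdist (x : α) : |R'.real (Set.Ici x) - R.real (Set.Ici x)| ≤ 2 * δ :=
    hR.abs_measureReal_sub_le_of_ordConnected Set.ordConnected_Ici
  have hRJ' : ∀ x ∈ J, ℓ / 2 ≤ R'.real (Set.Ici x) := fun x hx => by
    linarith [hRJ x hx, (_root_.abs_le.1 (hdist x)).1]
  have hw := hκ.mul_one_div_measureReal_Ici hℓ hRJ
  have hw' := hκ.mul_one_div_measureReal_Ici (half_pos hℓ) hRJ'
  have hδ0 : 0 ≤ δ := (abs_nonneg _).trans (hR ∅ isLowerSet_empty)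
  have hC := hκ.nonneg
  have hweight (x : α) :
      ‖κ x * (1 / R'.real (Set.Ici x)) - κ x * (1 / R.real (Set.Ici x))‖ ≤
        C * (2 / ℓ ^ 2 * (2 * δ)) := by
    rw [← mul_sub, Real.norm_eq_abs, abs_mul]
    by_cases hx : x ∈ J
    · exact mul_le_mul (hκ.abs_le x)
        (abs_one_div_sub_one_div_le hℓ (hRJ x hx) (hRJ' x hx) (hdist x)) (abs_nonneg _) hC
    · rw [hκ.eq_zero x hx, abs_zero, zero_mul]
      positivity
  have hchange_weight : |∫ x, κ x * (1 / R'.real (Set.Ici x)) ∂ν' -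
      ∫ x, κ x * (1 / R.real (Set.Ici x)) ∂ν'| ≤ C * (2 / ℓ ^ 2 * (2 * δ)) := by
    rw [← integral_sub (hw'.integrable ν') (hw.integrable ν'), ← Real.norm_eq_abs]
    exact (norm_integral_le_of_norm_le_const (ae_of_all _ hweight)).trans
      (mul_le_of_le_one_right (by positivity) hν')
  calc _ ≤ C * (2 / ℓ ^ 2 * (2 * δ)) + 4 * (C * (1 / ℓ)) * δ :=
        (abs_sub_le _ _ _).trans (add_le_add hchange_weight (hw.abs_integral_sub_le hν))
    _ = (4 * C / ℓ ^ 2 + 4 * C / ℓ) * δ := by ring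

end MonotoneDifference

end KernelIntegrals

section Smoothing

/-- The integrand `x ↦ k ((t - x) / b)` of `smooth k b a`, extended by zero off `(a, ∞)`. -/
noncomputable def smoothingKernel (k : ℝ → ℝ) (b a t : ℝ) : ℝ → ℝ :=
  (Set.Ioi a).indicator fun x => k ((t - x) / b)

theorem smooth_eq_integral_smoothingKernel (k : ℝ → ℝ) (b a t : ℝ) (ν : Measure ℝ) :
    smooth k b a ν t = b⁻¹ * ∫ x, smoothingKernel k b a t x ∂ν := by
  rw [smooth, smoothingKernel, integral_indicator measurableSet_Ioi]

theorem monotoneDifference_smoothingKernel {k : ℝ → ℝ} {I : Set ℝ} {C : ℝ}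
    (hk : MonotoneDifference k I C) {b : ℝ} (hb : 0 < b) (a t : ℝ) :
    MonotoneDifference (smoothingKernel k b a t)
      (Set.Ioi a ∩ (fun x => (t - x) / b) ⁻¹' I) C :=
  (hk.comp_antitone fun _ _ hxy =>
    div_le_div_of_nonneg_right (sub_le_sub_left hxy t) hb.le).indicator Set.ordConnected_Ioi

end Smoothing

section Hazard

variable {ρ σ : Measure ℝ}

theorem subLaw_uncensored_prod [SFinite σ] :
    subLaw uncensored Prod.fst (ρ.prod σ) = ρ.withDensity fun x => σ (Set.Ici x) := by
  ext S hS
  have hm : MeasurableSet (Prod.fst ⁻¹' S ∩ uncensored) :=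
    (measurable_fst hS).inter measurableSet_uncensored
  rw [subLaw, Measure.map_apply measurable_fst hS, Measure.restrict_apply (measurable_fst hS),
    Measure.prod_apply hm, withDensity_apply _ hS, ← lintegral_indicator hS]
  refine lintegral_congr fun x => ?_
  by_cases hx : x ∈ S
  · rw [Set.indicator_of_mem hx]
    exact congrArg σ (Set.ext fun y => and_iff_right hx)
  · rw [Set.indicator_of_notMem hx, ← measure_empty (μ := σ)]
    exact congrArg σ (Set.eq_empty_of_forall_notMem fun y hy => hx hy.1)

theorem measureReal_subLaw_minPair_prod_Ici [SFinite σ] (x : ℝ) :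
    (subLaw Set.univ minPair (ρ.prod σ)).real (Set.Ici x) =
      ρ.real (Set.Ici x) * σ.real (Set.Ici x) := by
  rw [measureReal_subLaw .univ measurable_minPair measurableSet_Ici, ← measureReal_prod_prod]
  congr 1
  ext z
  simp only [Set.univ_inter, Set.mem_preimage, minPair, Set.mem_Ici, le_min_iff, Set.mem_prod]

variable [IsProbabilityMeasure ρ] {f : ℝ → ℝ}

theorem one_sub_cdf_eq_measureReal_Ici [NullSingletonClass ρ] (x : ℝ) :
    1 - cdf ρ x = ρ.real (Set.Ici x) := by
  rw [cdf_eq_real, ← probReal_compl_eq_one_sub measurableSet_Iic, Set.compl_Iic]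
  exact measureReal_congr Ioi_ae_eq_Ici

theorem cumHazard_cdf_eq_withDensity (hfm : Measurable f) (hf0 : ∀ x, 0 ≤ f x)
    (hρ : ρ = volume.withDensity fun x => ENNReal.ofReal (f x)) :
    cumHazard f (cdf ρ) = ρ.withDensity fun x => ENNReal.ofReal (1 / ρ.real (Set.Ici x)) := by
  have : NullSingletonClass ρ := hρ ▸ inferInstance
  have hdensity : (fun x => ENNReal.ofReal (hazard f (cdf ρ) x)) =
      (fun x => ENNReal.ofReal (f x)) * fun x => ENNReal.ofReal (1 / (1 - cdf ρ x)) := by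
    ext x
    rw [hazard, div_eq_mul_one_div, ENNReal.ofReal_mul (hf0 x), Pi.mul_apply]
  have hcdf : Measurable (cdf ρ) := (monotone_cdf ρ).measurable
  rw [cumHazard, hdensity, withDensity_mul _ (by fun_prop) (by fun_prop), ← hρ]
  simp only [one_sub_cdf_eq_measureReal_Ici]

theorem integral_cumHazard_cdf [IsFiniteMeasure σ] (hfm : Measurable f) (hf0 : ∀ x, 0 ≤ f x)
    (hρ : ρ = volume.withDensity fun x => ENNReal.ofReal (f x)) {φ : ℝ → ℝ}
    (hφ : ∀ x, φ x ≠ 0 → σ.real (Set.Ici x) ≠ 0) :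
    ∫ x, φ x ∂cumHazard f (cdf ρ) =
      ∫ x, φ x * (1 / (subLaw Set.univ minPair (ρ.prod σ)).real (Set.Ici x))
        ∂subLaw uncensored Prod.fst (ρ.prod σ) := by
  have hsurv (ν : Measure ℝ) [IsFiniteMeasure ν] : Antitone fun x => ν (Set.Ici x) :=
    fun _ _ hxy => measure_mono (Set.Ici_subset_Ici.2 hxy)
  have hρm : Measurable fun x => ENNReal.ofReal (1 / ρ.real (Set.Ici x)) :=
    ((hsurv ρ).measurable.ennreal_toReal.const_div 1).ennreal_ofReal
  rw [cumHazard_cdf_eq_withDensity hfm hf0 hρ, subLaw_uncensored_prod,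
    integral_withDensity_eq_integral_toReal_smul hρm (ae_of_all _ fun _ => ENNReal.ofReal_lt_top),
    integral_withDensity_eq_integral_toReal_smul (hsurv σ).measurable
      (ae_of_all _ fun _ => measure_lt_top _ _)]
  refine integral_congr_ae (ae_of_all _ fun x => ?_)
  change (ENNReal.ofReal (1 / ρ.real (Set.Ici x))).toReal * φ x = σ.real (Set.Ici x) * _
  rw [ENNReal.toReal_ofReal (by positivity), measureReal_subLaw_minPair_prod_Ici]
  by_cases hx : φ x = 0
  · simp [hx]
  · have hσ := hφ x hx
    field

end Hazard

section Sample

theorem subLaw_empiricalMeasure {E α : Type*} [MeasurableSpace E] [MeasurableSpace α] {D : Set E}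
    {ζ : E → α} (hD : MeasurableSet D) (hζ : Measurable ζ) [DecidablePred (· ∈ D)] (z : ℕ → E)
    (n : ℕ) : subLaw D ζ (empiricalMeasure z n) =
      (n : ENNReal)⁻¹ • ∑ i ∈ (Finset.range n).filter (z · ∈ D), Measure.dirac (ζ (z i)) := by
  ext S hS
  rw [subLaw, Measure.map_apply hζ hS, Measure.restrict_apply (hζ hS), empiricalMeasure,
    Measure.smul_apply, Measure.smul_apply, Measure.finsetSum_apply, Measure.finsetSum_apply,
    Finset.sum_filter]
  congr 1
  refine Finset.sum_congr rfl fun i _ => ?_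
  rw [Measure.dirac_apply' _ ((hζ hS).inter hD), Measure.dirac_apply' _ hS]
  by_cases hi : z i ∈ D
  · rw [if_pos hi]
    exact Set.indicator_const_eq_indicator_const (and_iff_left hi)
  · rw [if_neg hi, Set.indicator_of_notMem fun h => hi h.2]

variable {Ω : Type*} (T Y : ℕ → Ω → ℝ) (n : ℕ) (ω : Ω)

theorem subEmpirical_eq_subLaw : subEmpirical T Y n ω =
    subLaw uncensored Prod.fst (empiricalMeasure (fun i => (T i ω, Y i ω)) n) := by
  classical
  rw [subLaw_empiricalMeasure measurableSet_uncensored measurable_fst, subEmpirical, eventMeasure]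
  congr 1
  refine Finset.sum_congr (by congr) fun i hi => ?_
  rw [obs, min_eq_left (Finset.mem_filter.1 hi).2]

theorem survivalEmpirical_eq_subLaw : survivalEmpirical T n ω =
    subLaw Set.univ Prod.fst (empiricalMeasure (fun i => (T i ω, Y i ω)) n) := by
  classical
  simp [subLaw_empiricalMeasure .univ measurable_fst, survivalEmpirical]

theorem measureReal_subLaw_minPair_empiricalMeasure_Ici (x : ℝ) :
    (subLaw Set.univ minPair (empiricalMeasure (fun i => (T i ω, Y i ω)) n)).real (Set.Ici x) =
      (n : ℝ)⁻¹ * atRisk T Y n ω x := by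
  classical
  rw [measureReal_subLaw .univ measurable_minPair measurableSet_Ici, Set.univ_inter,
    measureReal_empiricalMeasure (measurable_minPair measurableSet_Ici), atRisk,
    Finset.natCast_card_filter]
  rfl

theorem antitone_atRisk : Antitone (atRisk T Y n ω) := fun _ _ hxy =>
  Finset.card_le_card (Finset.monotone_filter_right _ fun _ _ h => hxy.trans h)

theorem ae_eventMeasure_atRisk_ne_zero : ∀ᵐ x ∂eventMeasure T Y n ω, atRisk T Y n ω x ≠ 0 := by
  classical
  rw [ae_iff, eventMeasure, Measure.finsetSum_apply _ _]
  refine Finset.sum_eq_zero fun i hi => ?_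
  have hself : 0 < atRisk T Y n ω (obs T Y i ω) :=
    Finset.card_pos.2 ⟨i, Finset.mem_filter.2 ⟨(Finset.mem_filter.1 hi).1, le_rfl⟩⟩
  rw [Measure.dirac_apply, Set.indicator_of_notMem (not_not.2 hself.ne')]

theorem integral_nelsonAalen (hn : n ≠ 0) (φ : ℝ → ℝ) :
    ∫ x, φ x ∂nelsonAalen T Y n ω =
      ∫ x, φ x * (1 / (subLaw Set.univ minPair
          (empiricalMeasure (fun i => (T i ω, Y i ω)) n)).real (Set.Ici x))
        ∂subLaw uncensored Prod.fst (empiricalMeasure (fun i => (T i ω, Y i ω)) n) := by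
  have hm : Measurable fun x => ((atRisk T Y n ω x : ℕ) : ENNReal)⁻¹ :=
    Monotone.measurable fun x y hxy =>
      ENNReal.inv_le_inv.2 (Nat.cast_le.2 (antitone_atRisk T Y n ω hxy))
  have hlt : ∀ᵐ x ∂eventMeasure T Y n ω, ((atRisk T Y n ω x : ℕ) : ENNReal)⁻¹ < ⊤ :=
    (ae_eventMeasure_atRisk_ne_zero T Y n ω).mono fun x hx =>
      ENNReal.inv_lt_top.2 (Nat.cast_pos.2 (Nat.pos_of_ne_zero hx))
  rw [nelsonAalen, integral_withDensity_eq_integral_toReal_smul hm hlt, ← subEmpirical_eq_subLaw,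
    subEmpirical, integral_smul_measure, smul_eq_mul, ← integral_const_mul]
  refine integral_congr_ae (ae_of_all _ fun x => ?_)
  have hn' : (n : ℝ) ≠ 0 := Nat.cast_ne_zero.2 hn
  simp only [measureReal_subLaw_minPair_empiricalMeasure_Ici, ENNReal.toReal_inv,
    ENNReal.toReal_natCast, smul_eq_mul]
  field

end Sample

section KernelEstimators

variable {k : ℝ → ℝ} {I : Set ℝ} {C b : ℝ}

theorem MonotoneDifference.abs_smooth_sub_le (hk : MonotoneDifference k I C) (hb : 0 < b)
    {ν₁ ν₂ : Measure ℝ} [IsFiniteMeasure ν₁] [IsFiniteMeasure ν₂] {δ : ℝ}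
    (h : KolmogorovClose ν₁ ν₂ δ) (a t : ℝ) :
    |smooth k b a ν₁ t - smooth k b a ν₂ t| ≤ b⁻¹ * (4 * C * δ) := by
  rw [smooth_eq_integral_smoothingKernel, smooth_eq_integral_smoothingKernel, ← mul_sub, abs_mul,
    abs_of_pos (inv_pos.2 hb)]
  gcongr
  exact (monotoneDifference_smoothingKernel hk hb a t).abs_integral_sub_le h

theorem MonotoneDifference.integral_smooth_empiricalMeasure (hk : MonotoneDifference k I C)
    (hb : 0 < b) {Ω E : Type*} [MeasurableSpace Ω] {μ : Measure Ω} [MeasurableSpace E]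
    {z : ℕ → Ω → E} (hz : ∀ i, Measurable (z i)) {P : Measure E} [IsFiniteMeasure P]
    (hP : ∀ i, μ.map (z i) = P) {D : Set E} {ζ : E → ℝ} (hD : MeasurableSet D)
    (hζ : Measurable ζ) {n : ℕ} (hn : n ≠ 0) (a t : ℝ) :
    ∫ ω, smooth k b a (subLaw D ζ (empiricalMeasure (z · ω) n)) t ∂μ =
      smooth k b a (subLaw D ζ P) t := by
  have hκ := monotoneDifference_smoothingKernel hk hb a t
  have hm : Measurable (D.indicator (smoothingKernel k b a t ∘ ζ)) :=
    (hκ.measurable.comp hζ).indicator hD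
  have hint : Integrable (D.indicator (smoothingKernel k b a t ∘ ζ)) P :=
    ((hκ.integrable (P.map ζ)).comp_measurable hζ).indicator hD
  simp only [smooth_eq_integral_smoothingKernel, integral_subLaw hD hζ hκ.measurable,
    integral_const_mul, integral_integral_empiricalMeasure hz hP hm hint hn]

theorem MonotoneDifference.abs_hazardEstimator_sub_hazardCentring_le
    (hk : MonotoneDifference k I C) (hb : 0 < b) {ρ σ : Measure ℝ} [IsProbabilityMeasure ρ]
    [IsFiniteMeasure σ] {f : ℝ → ℝ} (hfm : Measurable f) (hf0 : ∀ x, 0 ≤ f x)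
    (hρ : ρ = volume.withDensity fun x => ENNReal.ofReal (f x)) {Ω : Type*} {T Y : ℕ → Ω → ℝ}
    {n : ℕ} (hn : n ≠ 0) {ω : Ω} {δ : ℝ}
    (hN : KolmogorovClose (subLaw uncensored Prod.fst
      (empiricalMeasure (fun i => (T i ω, Y i ω)) n)) (subLaw uncensored Prod.fst (ρ.prod σ)) δ)
    (hX : KolmogorovClose (subLaw Set.univ minPair
      (empiricalMeasure (fun i => (T i ω, Y i ω)) n)) (subLaw Set.univ minPair (ρ.prod σ)) δ)
    {c ℓ : ℝ} (hℓ : 0 < ℓ) (hδ : 4 * δ ≤ ℓ)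
    (hc : ℓ ≤ (subLaw Set.univ minPair (ρ.prod σ)).real (Set.Ici c)) (a : ℝ) {t : ℝ}
    (ht : ∀ x, (t - x) / b ∈ I → x ≤ c) :
    |hazardEstimator T Y k b a n t ω - hazardCentring f (cdf ρ) k b a t| ≤
      b⁻¹ * ((4 * C / ℓ ^ 2 + 4 * C / ℓ) * δ) := by
  have hκ := monotoneDifference_smoothingKernel hk hb a t
  have hrisk : ∀ x ∈ Set.Ioi a ∩ (fun x => (t - x) / b) ⁻¹' I,
      ℓ ≤ (subLaw Set.univ minPair (ρ.prod σ)).real (Set.Ici x) := fun x hx =>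
    hc.trans (measureReal_mono (Set.Ici_subset_Ici.2 (ht x hx.2)))
  have hσ (x : ℝ) (hx : smoothingKernel k b a t x ≠ 0) : σ.real (Set.Ici x) ≠ 0 := by
    have hpos := hℓ.trans_le (hrisk x (not_not.1 fun h => hx (hκ.eq_zero x h)))
    rw [measureReal_subLaw_minPair_prod_Ici] at hpos
    exact right_ne_zero_of_mul hpos.ne'
  rw [hazardEstimator, hazardCentring, smooth_eq_integral_smoothingKernel,
    smooth_eq_integral_smoothingKernel, integral_nelsonAalen T Y n ω hn,
    integral_cumHazard_cdf hfm hf0 hρ hσ, ← mul_sub, abs_mul, abs_of_pos (inv_pos.2 hb)]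
  gcongr
  exact hκ.abs_integral_mul_one_div_sub_le hN hX
    (measureReal_subLaw_univ_le_one measurableSet_uncensored measurable_fst) hℓ hδ hrisk

end KernelEstimators

section Rate

theorem tendsto_sqrt_log_div :
    Tendsto (fun n : ℕ => Real.sqrt (Real.log n / n)) atTop (𝓝 0) := by
  have h := Real.isLittleO_log_id_atTop.tendsto_div_nhds_zero.comp tendsto_natCast_atTop_atTop
  rw [← Real.sqrt_zero]
  exact (Real.continuous_sqrt.tendsto 0).comp h

variable {τ : ℝ} {b : ℕ → ℝ}

theorem UniformRate.sub_div {A B : ℕ → ℝ → ℝ} (hA : UniformRate τ b A) (hB : UniformRate τ b B)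
    {W : ℝ → ℝ} {ℓ : ℝ} (hℓ : 0 < ℓ) (hW : ∀ t ∈ Set.Ioc 0 τ, ℓ ≤ W t) :
    UniformRate τ b fun n t => A n t - B n t / W t := by
  obtain ⟨K, hK⟩ := hA
  obtain ⟨M, hM⟩ := hB
  refine ⟨K + M / ℓ, ?_⟩
  filter_upwards [hK, hM] with n hKn hMn t ht
  set ε := (b n)⁻¹ * Real.sqrt (Real.log n / n)
  have hquot : |B n t / W t| ≤ M * ε / ℓ := by
    rw [abs_div, abs_of_pos (hℓ.trans_le (hW t ht))]
    exact div_le_div₀ ((abs_nonneg _).trans (hMn t ht)) (hMn t ht) hℓ (hW t ht)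
  calc |A n t - B n t / W t| ≤ K * ε + M * ε / ℓ :=
        (abs_sub _ _).trans (add_le_add (hKn t ht) hquot)
    _ = (K + M / ℓ) * ε := by ring

variable {k : ℝ → ℝ} {I : Set ℝ} {C : ℝ}

theorem MonotoneDifference.uniformRate_smooth_sub_integral (hk : MonotoneDifference k I C)
    (hb : ∀ᶠ n in atTop, 0 < b n) {Ω E : Type*} [MeasurableSpace Ω] {μ : Measure Ω}
    [MeasurableSpace E] {z : ℕ → Ω → E} (hz : ∀ i, Measurable (z i)) {P : Measure E}
    [IsFiniteMeasure P] (hP : ∀ i, μ.map (z i) = P) {D : Set E} {ζ : E → ℝ}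
    (hD : MeasurableSet D) (hζ : Measurable ζ) (a : ℝ) {ω : Ω}
    (h : ∀ᶠ n : ℕ in atTop, KolmogorovClose (subLaw D ζ (empiricalMeasure (z · ω) n))
      (subLaw D ζ P) (3 * Real.sqrt (Real.log n / n))) :
    UniformRate τ b fun n t => smooth k (b n) a (subLaw D ζ (empiricalMeasure (z · ω) n)) t -
      ∫ ω', smooth k (b n) a (subLaw D ζ (empiricalMeasure (z · ω') n)) t ∂μ := by
  refine ⟨12 * C, ?_⟩
  filter_upwards [h, hb, eventually_ne_atTop 0] with n hn hbn hn0 t _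
  rw [hk.integral_smooth_empiricalMeasure hbn hz hP hD hζ hn0]
  exact (hk.abs_smooth_sub_le hbn hn a t).trans_eq (by ring)

theorem MonotoneDifference.uniformRate_hazardEstimator_sub_hazardCentring
    (hk : MonotoneDifference k I C) (hI : BddBelow I) (hb : Tendsto b atTop (𝓝[>] 0))
    {ρ σ : Measure ℝ} [IsProbabilityMeasure ρ] [IsFiniteMeasure σ] {f : ℝ → ℝ}
    (hfm : Measurable f) (hf0 : ∀ x, 0 ≤ f x)
    (hρ : ρ = volume.withDensity fun x => ENNReal.ofReal (f x)) {c : ℝ} (hτc : τ < c)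
    (hc : 0 < (subLaw Set.univ minPair (ρ.prod σ)).real (Set.Ici c)) (a : ℝ)
    {Ω : Type*} {T Y : ℕ → Ω → ℝ} {ω : Ω}
    (hN : ∀ᶠ n : ℕ in atTop, KolmogorovClose
      (subLaw uncensored Prod.fst (empiricalMeasure (fun i => (T i ω, Y i ω)) n))
      (subLaw uncensored Prod.fst (ρ.prod σ)) (3 * Real.sqrt (Real.log n / n)))
    (hX : ∀ᶠ n : ℕ in atTop, KolmogorovClose
      (subLaw Set.univ minPair (empiricalMeasure (fun i => (T i ω, Y i ω)) n))
      (subLaw Set.univ minPair (ρ.prod σ)) (3 * Real.sqrt (Real.log n / n))) :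
    UniformRate τ b fun n t =>
      hazardEstimator T Y k (b n) a n t ω - hazardCentring f (cdf ρ) k (b n) a t := by
  obtain ⟨r, hr⟩ := hI
  set ℓ := (subLaw Set.univ minPair (ρ.prod σ)).real (Set.Ici c)
  have hwindow : ∀ᶠ n in atTop, τ - b n * r < c := by
    have hlim : Tendsto (fun n => τ - b n * r) atTop (𝓝 (τ - 0 * r)) :=
      ((tendsto_nhds_of_tendsto_nhdsWithin hb).mul_const r).const_sub τ
    exact hlim.eventually_lt_const (by simpa using hτc)
  have hsmall : ∀ᶠ n : ℕ in atTop, Real.sqrt (Real.log n / n) < ℓ / 12 :=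
    tendsto_sqrt_log_div.eventually_lt_const (by positivity)
  refine ⟨3 * (4 * C / ℓ ^ 2 + 4 * C / ℓ), ?_⟩
  filter_upwards [hN, hX, hwindow, hsmall, hb.eventually self_mem_nhdsWithin,
    eventually_ne_atTop 0] with n hNn hXn hwn hsn hbn hn0 t ht
  refine (hk.abs_hazardEstimator_sub_hazardCentring_le hbn hfm hf0 hρ hn0 hNn hXn hc
    (by linarith) le_rfl a fun x hx => ?_).trans_eq (by ring)
  have hxr := (le_div_iff₀ hbn).1 (hr hx)
  linarith [ht.2]

end Rate

section EndpointsAndLaws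

theorem exists_lt_of_lt_rightEndpoint {H : ℝ → ℝ} {τ : ℝ} (h : (τ : EReal) < rightEndpoint H) :
    ∃ c, τ < c ∧ H c < 1 := by
  obtain ⟨c, hc⟩ := lt_iSup_iff.1 h
  obtain ⟨hHc, hτc⟩ := lt_iSup_iff.1 hc
  exact ⟨c, EReal.coe_lt_coe_iff.1 hτc, hHc⟩

variable {Ω : Type*} [MeasurableSpace Ω] {μ : Measure Ω} {T Y : ℕ → Ω → ℝ}

theorem one_sub_distFun_obs_le [IsProbabilityMeasure μ] {i : ℕ} (hT : Measurable (T i))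
    (hY : Measurable (Y i)) (x : ℝ) : 1 - distFun μ (obs T Y i) x ≤
      (subLaw Set.univ minPair (μ.map fun ω => (T i ω, Y i ω))).real (Set.Ici x) := by
  have hobs : Measurable (obs T Y i) := hT.min hY
  have := Measure.isProbabilityMeasure_map (μ := μ) hobs.aemeasurable
  have hlaw : subLaw Set.univ minPair (μ.map fun ω => (T i ω, Y i ω)) = μ.map (obs T Y i) := by
    rw [subLaw, Measure.restrict_univ, Measure.map_map measurable_minPair (hT.prodMk hY)]
    rfl
  rw [distFun, cdf_eq_real, ← probReal_compl_eq_one_sub measurableSet_Iic, Set.compl_Iic, hlaw]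
  exact measureReal_mono Set.Ioi_subset_Ici_self

theorem IndepNAPair.map_pair_eq_prod [IsFiniteMeasure μ] (hp : IndepNAPair μ T Y) (i : ℕ) :
    μ.map (fun ω => (T i ω, Y i ω)) = (μ.map (T i)).prod (μ.map (Y i)) :=
  (indepFun_iff_map_prod_eq_prod_map_map (hp.left_meas i).aemeasurable
    (hp.right_meas i).aemeasurable).1
    (hp.indep.comp (measurable_pi_apply i) (measurable_pi_apply i))

end EndpointsAndLaws

end CensoredNA

open CensoredNA in
theorem theorem2_general {Ω : Type*} [MeasurableSpace Ω] {μ : Measure Ω} [IsProbabilityMeasure μ]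
    {T Y : ℕ → Ω → ℝ} (hTm : ∀ i, Measurable (T i)) (hYm : ∀ i, Measurable (Y i))
    (hTid : ∀ i, μ.map (T i) = μ.map (T 0)) (hYid : ∀ i, μ.map (Y i) = μ.map (Y 0))
    (hTNA : NegAssociated μ T) (hYNA : NegAssociated μ Y)
    (hTY : IndepFun (fun ω i => T i ω) (fun ω i => Y i ω) μ) {τ : ℝ}
    (hτ : (τ : EReal) < rightEndpoint (distFun μ (obs T Y 0)))
    {f : ℝ → ℝ} (hfm : Measurable f) (hf0 : ∀ x, 0 ≤ f x)
    (hf : μ.map (T 0) = volume.withDensity fun x => ENNReal.ofReal (f x))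
    {k : ℝ → ℝ} {I : Set ℝ} (hI : I.OrdConnected) (hI_bdd : BddBelow I)
    (hk : BoundedVariationOn k I) (hk0 : ∀ u ∉ I, k u = 0)
    {b : ℕ → ℝ} (hb : Tendsto b atTop (𝓝[>] 0)) (a : ℝ) :
    (∀ᵐ ω ∂μ, UniformRate τ b fun n t =>
      hazardEstimator T Y k (b n) a n t ω - hazardCentring f (distFun μ (T 0)) k (b n) a t -
        (fStar T Y k (b n) a n t ω - ∫ ω', fStar T Y k (b n) a n t ω' ∂μ) /
          (1 - distFun μ (obs T Y 0) t)) ∧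
    (∀ᵐ ω ∂μ, UniformRate τ b fun n t =>
      hazardEstimator T Y k (b n) a n t ω - hazardCentring f (distFun μ (T 0)) k (b n) a t -
        (fStarSurvival T k (b n) a n t ω - ∫ ω', fStarSurvival T k (b n) a n t ω' ∂μ) /
          (1 - distFun μ (obs T Y 0) t)) := by
  have hp : IndepNAPair μ T Y := ⟨hTNA, hYNA, hTm, hYm, hTY⟩
  obtain ⟨C, hkC⟩ := exists_monotoneDifference hI hk hk0
  obtain ⟨c, hτc, hc⟩ := exists_lt_of_lt_rightEndpoint hτ
  have hL : ∀ t ∈ Set.Ioc 0 τ, 1 - distFun μ (obs T Y 0) c ≤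
      1 - distFun μ (obs T Y 0) t := fun t ht =>
    sub_le_sub_left (monotone_cdf _ (ht.2.trans hτc.le)) 1
  have hP (i : ℕ) : μ.map (fun ω => (T i ω, Y i ω)) = (μ.map (T 0)).prod (μ.map (Y 0)) := by
    rw [hp.map_pair_eq_prod i, hTid i, hYid i]
  have hPT := Measure.isProbabilityMeasure_map (μ := μ) (hTm 0).aemeasurable
  have hPY := Measure.isProbabilityMeasure_map (μ := μ) (hYm 0).aemeasurable
  have hrisk := (sub_pos.2 hc).trans_le (one_sub_distFun_obs_le (hTm 0) (hYm 0) c)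
  rw [hP 0] at hrisk
  have hbpos : ∀ᶠ n in atTop, 0 < b n := hb.eventually self_mem_nhdsWithin
  have hN := hp.ae_eventually_kolmogorovClose hP measurableSet_uncensored measurable_fst
    fun _ => coordMonotone_indicator_uncensored
  have hX := hp.ae_eventually_kolmogorovClose hP .univ measurable_minPair
    fun _ => coordMonotone_indicator_minPair
  have hS := hp.ae_eventually_kolmogorovClose hP .univ measurable_fst
    fun _ => coordMonotone_indicator_fst
  have hpair (i : ℕ) : Measurable fun ω => (T i ω, Y i ω) := (hTm i).prodMk (hYm i)
  have hhazard : ∀ᵐ ω ∂μ, UniformRate τ b fun n t => hazardEstimator T Y k (b n) a n t ω -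
      hazardCentring f (distFun μ (T 0)) k (b n) a t := by
    filter_upwards [hN, hX] with ω using
      hkC.uniformRate_hazardEstimator_sub_hazardCentring hI_bdd hb hfm hf0 hf hτc hrisk a
  have hfStar : ∀ᵐ ω ∂μ, UniformRate τ b fun n t =>
      fStar T Y k (b n) a n t ω - ∫ ω', fStar T Y k (b n) a n t ω' ∂μ := by
    simp only [fStar, subEmpirical_eq_subLaw]
    filter_upwards [hN] with ω using
      hkC.uniformRate_smooth_sub_integral hbpos hpair hP measurableSet_uncensored measurable_fst a
  have hfStarSurvival : ∀ᵐ ω ∂μ, UniformRate τ b fun n t =>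
      fStarSurvival T k (b n) a n t ω - ∫ ω', fStarSurvival T k (b n) a n t ω' ∂μ := by
    simp only [fStarSurvival, survivalEmpirical_eq_subLaw T Y]
    filter_upwards [hS] with ω using
      hkC.uniformRate_smooth_sub_integral hbpos hpair hP .univ measurable_fst a
  constructor
  · filter_upwards [hhazard, hfStar] with ω h₁ h₂ using h₁.sub_div h₂ (sub_pos.2 hc) hL
  · filter_upwards [hhazard, hfStarSurvival] with ω h₁ h₂ using h₁.sub_div h₂ (sub_pos.2 hc) hL

theorem theorem2 {Ω : Type*} [MeasurableSpace Ω] (μ : Measure Ω) [IsProbabilityMeasure μ]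
    -- survival and censoring times: nonnegative, with common laws, each sequence NA,
    -- the two sequences independent of each other
    (T Y : ℕ → Ω → ℝ)
    (hTm : ∀ i, Measurable (T i)) (hYm : ∀ i, Measurable (Y i))
    (hT0 : ∀ i, ∀ᵐ ω ∂μ, 0 ≤ T i ω) (hY0 : ∀ i, ∀ᵐ ω ∂μ, 0 ≤ Y i ω)
    (hTid : ∀ i, μ.map (T i) = μ.map (T 0)) (hYid : ∀ i, μ.map (Y i) = μ.map (Y 0))
    (hTNA : CensoredNA.NegAssociated μ T) (hYNA : CensoredNA.NegAssociated μ Y)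
    (hTY : IndepFun (fun ω i => T i ω) (fun ω i => Y i ω) μ)
    -- distribution functions of `T i` and of `X i = min (T i) (Y i)`, and the left endpoint of `F`
    (F L : ℝ → ℝ) (hF : F = CensoredNA.distFun μ (T 0))
    (hL : L = CensoredNA.distFun μ (CensoredNA.obs T Y 0))
    (a : ℝ) (ha : a = CensoredNA.leftEndpoint F)
    (τ : ℝ) (hτ_left : a < τ)
    (hτ_right : (τ : EReal) < CensoredNA.rightEndpoint L)
    -- `f` is the density of `T i`, `g` the density of `Y i` on `[0, τ]`; bounded on `[0, τ]`
    (f g : ℝ → ℝ) (hfm : Measurable f) (hgm : Measurable g)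
    (hf0 : ∀ x, 0 ≤ f x) (hg0 : ∀ x, 0 ≤ g x)
    (hf : μ.map (T 0) = volume.withDensity fun x => ENNReal.ofReal (f x))
    (hg : (μ.map (Y 0)).restrict (Set.Icc 0 τ) =
      (volume.restrict (Set.Icc 0 τ)).withDensity fun x => ENNReal.ofReal (g x))
    (hfb : ∃ M : ℝ, ∀ x ∈ Set.Icc 0 τ, f x ≤ M) (hgb : ∃ M : ℝ, ∀ x ∈ Set.Icc 0 τ, g x ≤ M)
    -- the kernel: a probability density of bounded variation on `(r, s)`
    (r s : ℝ) (hr : r < 0) (hs : 0 < s) (k : ℝ → ℝ)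
    (hk0 : ∀ u, 0 ≤ k u) (hksupp : ∀ u, u ∉ Set.Ioo r s → k u = 0)
    (hkint : ∫ u, k u = 1) (hkbv : BoundedVariationOn k (Set.Ioo r s))
    -- the bandwidths
    (b : ℕ → ℝ) (hb_pos : ∀ n, 1 ≤ n → 0 < b n) (hb_zero : Tendsto b atTop (𝓝 0))
    (hb_rate : (fun n : ℕ => (b n)⁻¹) =o[atTop] fun n : ℕ => Real.sqrt ((n : ℝ) / Real.log n)) :
    -- the claim, for either reading of `F_{*n}` in `f_n^*`
    (∀ᵐ ω ∂μ, CensoredNA.UniformRate τ b fun n t =>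
      CensoredNA.hazardEstimator T Y k (b n) a n t ω - CensoredNA.hazardCentring f F k (b n) a t -
        (CensoredNA.fStar T Y k (b n) a n t ω -
          ∫ ω', CensoredNA.fStar T Y k (b n) a n t ω' ∂μ) / (1 - L t)) ∧
    (∀ᵐ ω ∂μ, CensoredNA.UniformRate τ b fun n t =>
      CensoredNA.hazardEstimator T Y k (b n) a n t ω - CensoredNA.hazardCentring f F k (b n) a t -
        (CensoredNA.fStarSurvival T k (b n) a n t ω -
          ∫ ω', CensoredNA.fStarSurvival T k (b n) a n t ω' ∂μ) / (1 - L t)) := by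
  subst hF hL
  exact theorem2_general hTm hYm hTid hYid hTNA hYNA hTY hτ_right hfm hf0 hf
    Set.ordConnected_Ioo bddBelow_Ioo hkbv hksupp
    (tendsto_nhdsWithin_iff.2 ⟨hb_zero, (eventually_ge_atTop 1).mono hb_pos⟩) a
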